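/- Let $M$ be the Pascal configuration: the simple rank-three matroid on $[9]=\{1,\dots,9\}$ whose lines are $\{1,6,8\},\{1,5,7\},\{2,4,7\},\{2,6,9\},\{3,4,8\},\{3,5,9\},\{7,8,9\}$; that is, a subset of $[9]$ is independent if and only if it has at most three elements and is not one of these seven lines. For a matroid $N$ on $[9]$, identify a collection of vectors $\gamma=(\gamma_1,\dots,\gamma_9)$ of $\mathbb{C}^3$ with a point of $\mathbb{C}^{27}$. Let $\Gamma_N\subset\mathbb{C}^{27}$ be the set of those $\gamma$ such that, for every $S\subseteq[9]$, the family $(\gamma_i)_{i\in S}$ is linearly dependent if and only if $S$ is dependent in $N$; let the matroid variety $V_N$ be the Zariski closure of $\Gamma_N$ in $\mathbb{C}^{27}$; and let the circuit variety $V_{\mathcal{C}(N)}$ be the set of those $\gamma$ such that $(\gamma_i)_{i\in S}$ is linearly dependent for every dependent set $S$ of $N$. Let $U_{2,9}$ be the uniform matroid of rank two on $[9]$ and, for $i\in[9]$, let $M(i)$ be the matroid on $[9]$ obtained from $M$ by making $i$ a loop, i.e. the matroid whose independent sets are the independent sets of $M$ that do not contain $i$. Then $$V_{\mathcal{C}(M)}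 = V_M \cup V_{U_{2,9}} \cup V_{M(7)} \cup V_{M(8)} \cup V_{M(9)},$$ and this is the irredundant decomposition of $V_{\mathcal{C}(M)}$ into irreducible components: each of the five sets on the right is Zariski closed and irreducible, and none of them is contained in another. -/

import Mathlib

open Set

/-! ## Affine space with the Zariski topology -/

/-- The Zariski topology on the affine space `σ → ℂ`: the closed sets are the zero loci of ideals
of polynomials. -/
@[reducible] def zariskiTopology (σ : Type*) : TopologicalSpace (σ → ℂ) :=
  TopologicalSpace.ofClosed
    {Z | ∃ I : Ideal (MvPolynomial σ ℂ), Z = MvPolynomial.zeroLocus ℂ I}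
    ⟨⊤, by simp⟩
    (by
      intro A hA
      refine ⟨⨆ I ∈ {I : Ideal (MvPolynomial σ ℂ) | MvPolynomial.zeroLocus ℂ I ∈ A}, I, ?_⟩
      apply subset_antisymm
      · refine MvPolynomial.le_zeroLocus_iff_le_vanishingIdeal.2 (iSup₂_le fun I hI => ?_)
        exact MvPolynomial.le_zeroLocus_iff_le_vanishingIdeal.1 (sInter_subset_of_mem hI)
      · refine subset_sInter fun Z hZ => ?_
        obtain ⟨I, rfl⟩ := hA hZ
        exact MvPolynomial.zeroLocus_anti_mono (le_iSup₂_of_le I hZ le_rfl))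
    (by
      rintro _ ⟨I, rfl⟩ _ ⟨J, rfl⟩
      refine ⟨I ⊓ J, subset_antisymm (union_subset ?_ ?_) ?_⟩
      · exact MvPolynomial.zeroLocus_anti_mono inf_le_left
      · exact MvPolynomial.zeroLocus_anti_mono inf_le_right
      · intro x hx
        by_contra hcon
        simp only [mem_union, MvPolynomial.mem_zeroLocus_iff, not_or, not_forall] at hcon
        obtain ⟨⟨p, hp, hpx⟩, r, hr, hrx⟩ := hcon
        have h := MvPolynomial.mem_zeroLocus_iff.1 hx (p * r)
          ⟨I.mul_mem_right r hp, J.mul_mem_left p hr⟩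
        rw [map_mul] at h
        exact (mul_ne_zero hpx hrx) h)

/-- `V` is the family of irreducible components of `W`, listed without repetition: `W` is the union
of the Zariski closed irreducible sets `V k`, and none of them is contained in another one. -/
structure IsIrredundantIrreducibleDecomposition {σ : Type*} {m : ℕ} (W : Set (σ → ℂ))
    (V : Fin m → Set (σ → ℂ)) : Prop where
  eq_iUnion : W = ⋃ k, V k
  isClosed : ∀ k, @IsClosed _ (zariskiTopology σ) (V k)
  isIrreducible : ∀ k, @IsIrreducible _ (zariskiTopology σ) (V k)
  irredundant : ∀ k l, k ≠ l → ¬ V k ⊆ V l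

/-! ## Realizations, matroid varieties and circuit varieties

All matroids below have the whole type `α` as ground set. A collection of vectors of `ℂ³` indexed
by `α` is a point of the affine space with coordinates indexed by `α × Fin 3`. -/

/-- The vector of `ℂ³` attached to `i`. -/
def vec {α : Type*} (γ : α × Fin 3 → ℂ) (i : α) : Fin 3 → ℂ := fun j => γ (i, j)

/-- The realization space: the collections of vectors in which exactly the dependent sets of `M`
are linearly dependent (as indexed families, so that equal vectors are dependent). -/
def realizationSpace {α : Type*} (M : Matroid α) : Set (α × Fin 3 → ℂ) :=
  {γ | ∀ S ⊆ M.E, M.Dep S ↔ ¬ LinearIndepOn ℂ (vec γ) S}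

/-- The matroid variety: the Zariski closure of the realization space. -/
def matroidVariety {α : Type*} (M : Matroid α) : Set (α × Fin 3 → ℂ) :=
  @closure _ (zariskiTopology (α × Fin 3)) (realizationSpace M)

/-- The circuit variety: the collections of vectors that include the dependencies of `M`. -/
def circuitVariety {α : Type*} (M : Matroid α) : Set (α × Fin 3 → ℂ) :=
  {γ | ∀ S, M.Dep S → ¬ LinearIndepOn ℂ (vec γ) S}

/-! ## The matroids -/

/-- The matroid `M(i)` obtained from `M` by making `i` a loop: delete `i`, then put it back as a
loop (`Matroid.restrict` turns the new elements of the ground set into loops). -/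
def makeLoop {α : Type*} (M : Matroid α) (i : α) : Matroid α :=
  (M.restrict (M.E \ {i})).restrict M.E

/-- The independent sets of `M(i)` are the independent sets of `M` that do not contain `i`. -/
theorem makeLoop_indep_iff {α : Type*} (M : Matroid α) (i : α) (S : Set α) :
    (makeLoop M i).Indep S ↔ M.Indep S ∧ i ∉ S := by
  simp only [makeLoop, Matroid.restrict_indep_iff]
  constructor
  · rintro ⟨⟨h, h1⟩, -⟩
    exact ⟨h, fun hi => (h1 hi).2 rfl⟩
  · rintro ⟨h, hi⟩
    refine ⟨⟨h, fun x hx => ⟨h.subset_ground hx, ?_⟩⟩, h.subset_ground⟩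
    rintro rfl
    exact hi hx

/-- The uniform matroid of rank two on `d` points. -/
def uniformTwo (d : ℕ) : Matroid (Fin d) :=
  (IndepMatroid.ofFinite (E := univ) finite_univ (fun S => S.ncard ≤ 2)
    (by simp)
    (fun I J hJ hIJ => (ncard_le_ncard hIJ (toFinite J)).trans hJ)
    (by
      intro I J _ hJ hlt
      obtain ⟨e, heJ, heI⟩ := exists_mem_notMem_of_ncard_lt_ncard hlt (toFinite I)
      refine ⟨e, heJ, heI, ?_⟩
      rw [ncard_insert_of_notMem heI (toFinite I)]
      omega)
    (fun _ _ => subset_univ _)).matroid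

/-- The seven lines of the Pascal configuration. The points are labelled `1, …, 9` and the labels
are read in `Fin 9`, where `9 = 0`. -/
def pascalLines : Finset (Finset (Fin 9)) :=
  {{1, 6, 8}, {1, 5, 7}, {2, 4, 7}, {2, 6, 9}, {3, 4, 8}, {3, 5, 9}, {7, 8, 9}}

/-- The Pascal configuration, the simple rank-three matroid with lines `pascalLines`: a set of
points is independent if it has at most three elements and is not one of the lines. -/
def pascal : Matroid (Fin 9) :=
  (IndepMatroid.ofFinset univ (fun S : Finset (Fin 9) => S.card ≤ 3 ∧ S ∉ pascalLines)
    (by decide)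
    (by
      intro I J hJ hIJ
      refine ⟨(Finset.card_le_card hIJ).trans hJ.1, fun hI => hJ.2 ?_⟩
      have h3 : ∀ l ∈ pascalLines, l.card = 3 := by
        decide +kernel
      rwa [← Finset.eq_of_subset_of_card_le hIJ (hJ.1.trans (h3 I hI).ge)])
    (by
      intro I J hI hJ hlt
      have h3 : ∀ l ∈ pascalLines, l.card = 3 := by
        decide +kernel
      have h1 : ∀ l ∈ pascalLines, ∀ l' ∈ pascalLines, 2 ≤ (l ∩ l').card → l = l' := by
        decide +kernel
      by_contra! hcon
      have hins : ∀ e ∈ J, e ∉ I → insert e I ∈ pascalLines := by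
        intro e heJ heI
        by_contra hl
        have := hcon e heJ heI
        rw [Finset.card_insert_of_notMem heI] at this
        exact hl (this (by have := hJ.1; omega))
      obtain ⟨e, heJ, heI⟩ := Finset.exists_mem_notMem_of_card_lt_card hlt
      have hl := hins e heJ heI
      have hc := h3 _ hl
      have hcI : I.card = 2 := by
        rw [Finset.card_insert_of_notMem heI] at hc
        omega
      have hsub : J ⊆ insert e I := by
        intro x hx
        by_cases hxI : x ∈ I
        · exact Finset.mem_insert_of_mem hxI
        · have : insert e I = insert x I := h1 _ hl _ (hins x hx hxI)
            (hcI.ge.trans (Finset.card_le_card (Finset.subset_inter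
              (Finset.subset_insert _ _) (Finset.subset_insert _ _))))
          rw [this]
          exact Finset.mem_insert_self _ _
      have : J = insert e I := Finset.eq_of_subset_of_card_le hsub (by omega)
      exact hJ.2 (this ▸ hl))
    (fun _ _ => subset_univ _)).matroid

open scoped Matrix

/-! The circuit variety is cut out of `ℂ²⁷` by seven determinants, one per line, so each of its
points `γ` lies on an irreducible closed subset of it of dimension at least `27 - 7 = 20`
(`exists_isPrime_le_trdeg`). The generic point of this subset is a configuration over its function
field `K` with the same seven collinearities, and its coordinates do not lie in a field generated
over `ℂ` by 19 elements. If it is a value of a parametrization of the realizations of a matroid `N`,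
its specialization `γ` lies in `V_N` (`Parametrizes.mem_of_generic`). So it suffices to classify
configurations over `K` and to count parameters (`PascalIncidence.classification`).

If 7, 8 or 9 is the zero vector, the lines through it impose nothing and the other four form a
quadrilateral with four corners and one more point on each side: `4 * 3 + 4 * 2 = 20` parameters,
and at most 19 if a corner vanishes or two consecutive corners are parallel. Otherwise 4, 2, 6, 1,
5, 3 is a hexagon whose sides pass through 7, 9, 8, 7, 9, 8. Walking along it, each new vertex costs
two parameters, even in degenerate positions (`PathBound.step`), and a vertex parallel to an
adjacent label saves one too many. If the planes of 2, 7 and 3, 8 differ and the labels are pairwise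
independent, 4 is on their intersection and the configuration is a value of `pascalParam`; in the
remaining cases everything is coplanar.

Each component is irreducible because its realizations are polynomially parametrized, so that its
ideal is the kernel of a map into a polynomial ring. Explicit polynomials give irredundance: the
coordinates of `i` for `M(i)`, the bracket of 1, 2, 3 for the uniform matroid, concurrency of the
three lines through `i` to separate `M(i)` from `M`, and a cyclic product of minors
(`liftingObstruction`) to separate the uniform matroid from `M`. -/

/-! ### Dimension theory: heights, Krull dimension and transcendence degree. -/

theorem MvPolynomial.height_of_isMaximal {k σ : Type*} [Field k] [Finite σ] :
    ∀ (m : Ideal (MvPolynomial σ k)) [m.IsMaximal], m.height = Nat.card σ := by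
  induction σ using Finite.induction_empty_option with
  | of_equiv e H =>
    intro m hm
    let E := (MvPolynomial.renameEquiv k e).toRingEquiv
    have h1 : (m.comap E).IsMaximal := Ideal.comap_isMaximal_of_equiv E
    have h2 := H (m.comap E)
    rw [RingEquiv.height_comap] at h2
    rw [h2, Nat.card_congr e]
  | h_empty =>
    intro m hm
    have hb : m = ⊥ := by
      have := (MvPolynomial.isEmptyAlgEquiv k PEmpty).toRingEquiv
      have hf : IsField (MvPolynomial PEmpty k) := this.toMulEquiv.isField (Field.toIsField k)
      let := hf.toField
      exact (Ideal.eq_bot_or_top m).resolve_right hm.ne_top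
    subst hb
    simp
  | h_option IH =>
    rename_i α _
    intro m hm
    let E := (MvPolynomial.optionEquivLeft k α).toRingEquiv
    have h1 : (m.comap E.symm).IsMaximal := Ideal.comap_isMaximal_of_equiv E.symm
    -- Polynomial rings over a field are Jacobson, so maximal ideals contract to maximal ideals; the
    -- extra variable then adds exactly one to the height.
    have hmax : ((m.comap E.symm).comap (Polynomial.C : MvPolynomial α k →+* _)).IsMaximal :=
      Polynomial.isMaximal_comap_C_of_isJacobsonRing (m.comap E.symm)
    have hlo : (m.comap E.symm).LiesOver ((m.comap E.symm).under (MvPolynomial α k)) := ⟨rfl⟩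
    have h2 := Polynomial.height_eq_height_add_one
      ((m.comap E.symm).under (MvPolynomial α k)) (m.comap E.symm)
    have h3 : ((m.comap E.symm).under (MvPolynomial α k)).height = Nat.card α := @IH _ hmax
    rw [RingEquiv.height_comap, h3] at h2
    rw [h2]
    simp

/-- Noether normalization: `A` is integral over a polynomial ring in `s` variables, `s` is at most
the transcendence degree, and chains of primes contract strictly along an integral extension. -/
theorem ringKrullDim_le_trdeg {k A : Type} [Field k] [CommRing A] [IsDomain A] [Algebra k A]
    [Algebra.FiniteType k A] {r : ℕ} (h : Algebra.trdeg k A ≤ r) : ringKrullDim A ≤ r := by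
  obtain ⟨s, g, hg, hi⟩ := exists_integral_inj_algHom_of_fg k A
  have hs : s ≤ r := by
    have h1 := trdeg_le_of_injective g hg
    rw [MvPolynomial.trdeg_of_isDomain] at h1
    have := h1.trans h
    simpa using this
  let := g.toRingHom.toAlgebra
  have : Algebra.IsIntegral (MvPolynomial (Fin s) k) A := ⟨hi⟩
  have h2 : ringKrullDim A ≤ ringKrullDim (MvPolynomial (Fin s) k) := by
    refine Order.krullDim_le_of_strictMono
      (PrimeSpectrum.comap (algebraMap (MvPolynomial (Fin s) k) A)) ?_
    intro p q hpq
    exact Ideal.IsIntegral.comap_lt_comap hpq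
  refine h2.trans ?_
  rw [MvPolynomial.ringKrullDim_of_isNoetherianRing, ringKrullDim_eq_zero_of_field]
  simpa using hs

/-- By Krull's height theorem a longest chain of primes between `s` and `m` has length at least
`Nat.card σ - c > r`. Its smallest member is `P`: the whole chain survives modulo `P`, so the
quotient has dimension greater than `r`. -/
theorem exists_isPrime_le_trdeg {k σ : Type} [Field k] [Finite σ]
    (s : Set (MvPolynomial σ k)) (m : Ideal (MvPolynomial σ k)) [hm : m.IsMaximal] (hs : s ⊆ m)
    {c r : ℕ} (hc : s.encard ≤ c) (hr : c + r < Nat.card σ) :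
    ∃ P : Ideal (MvPolynomial σ k), P.IsPrime ∧ s ⊆ P ∧ P ≤ m ∧
      ¬ Algebra.trdeg k (MvPolynomial σ k ⧸ P) ≤ r := by
  have h1 := Ideal.height_le_height_add_encard_of_subset s (p := m) hs
  rw [MvPolynomial.height_of_isMaximal] at h1
  set I := Ideal.span s
  have hI : I ≤ m := Ideal.span_le.2 hs
  have : (m.map (Ideal.Quotient.mk I)).IsPrime := Ideal.isPrime_map_quotientMk_of_isPrime hI
  obtain ⟨l, hl, hlen⟩ := Ideal.exists_ltSeries_length_eq_height (m.map (Ideal.Quotient.mk I))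
  have h2 : r + 1 ≤ l.length := by
    rw [← hlen] at h1
    have h3 : (Nat.card σ : ℕ∞) ≤ (l.length + c : ℕ) := by
      push_cast
      exact h1.trans (by gcongr)
    have := Nat.cast_le.1 h3
    omega
  let P : Ideal (MvPolynomial σ k) := l.head.asIdeal.comap (Ideal.Quotient.mk I)
  have hP : P.IsPrime := inferInstance
  refine ⟨P, hP, ?_, ?_, ?_⟩
  · intro f hf
    change Ideal.Quotient.mk I f ∈ l.head.asIdeal
    rw [Ideal.Quotient.eq_zero_iff_mem.2 (Ideal.subset_span hf)]
    exact zero_mem _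
  · have h3 : l.head.asIdeal ≤ m.map (Ideal.Quotient.mk I) := by
      have := l.head_le_last
      rw [hl] at this
      exact this
    refine (Ideal.comap_mono h3).trans ?_
    rw [Ideal.comap_map_of_surjective' _ Ideal.Quotient.mk_surjective, Ideal.mk_ker]
    exact sup_le le_rfl hI
  · intro htr
    have h4 := ringKrullDim_le_trdeg htr
    have hker : ∀ i, P ≤ (l i).asIdeal.comap (Ideal.Quotient.mk I) := fun i =>
      Ideal.comap_mono (l.head_le i)
    let F : Fin (l.length + 1) → PrimeSpectrum (MvPolynomial σ k ⧸ P) := fun i =>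
      ⟨((l i).asIdeal.comap (Ideal.Quotient.mk I)).map (Ideal.Quotient.mk P),
        Ideal.isPrime_map_quotientMk_of_isPrime (hker i)⟩
    have hF : StrictMono F := by
      intro i j hij
      have hlt : l i < l j := l.strictMono hij
      have hcm : ∀ i, ((F i).asIdeal).comap (Ideal.Quotient.mk P)
          = (l i).asIdeal.comap (Ideal.Quotient.mk I) := fun i => by
        change (Ideal.map _ _).comap _ = _
        rw [Ideal.comap_map_of_surjective' _ Ideal.Quotient.mk_surjective, Ideal.mk_ker]
        exact sup_eq_left.2 (hker i)
      refine lt_of_le_of_ne (Ideal.map_mono (Ideal.comap_mono hlt.le)) fun h => ?_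
      have h5 := hcm i
      rw [h, hcm j] at h5
      have := Ideal.comap_injective_of_surjective _ Ideal.Quotient.mk_surjective h5
      exact hlt.ne (PrimeSpectrum.ext this.symm)
    have h5 := Order.LTSeries.length_le_krullDim (LTSeries.mk l.length F hF)
    have h6 : ((l.length : ℕ) : WithBot ℕ∞) ≤ r := h5.trans h4
    have : l.length ≤ r := by exact_mod_cast h6
    omega

theorem MvPolynomial.trdeg_le_of_surjective {k σ A K : Type} [Field k] [CommRing A] [IsDomain A]
    [Algebra k A] [Field K] [Algebra A K] [Algebra k K] [IsScalarTower k A K] [IsFractionRing A K]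
    (g : MvPolynomial σ k →ₐ[k] A) (hg : Function.Surjective g) (t : Finset K)
    (ht : ∀ i, algebraMap A K (g (MvPolynomial.X i)) ∈ IntermediateField.adjoin k (t : Set K)) :
    Algebra.trdeg k A ≤ t.card := by
  have h0 : ∀ f : MvPolynomial σ k, algebraMap A K (g f) ∈
      IntermediateField.adjoin k (t : Set K) := by
    intro f
    induction f using MvPolynomial.induction_on with
    | C a =>
      rw [← MvPolynomial.algebraMap_eq, AlgHom.commutes, ← IsScalarTower.algebraMap_apply]
      exact IntermediateField.algebraMap_mem _ a
    | add p q hp hq => rw [map_add, map_add]; exact add_mem hp hq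
    | mul_X p i hp => rw [map_mul, map_mul]; exact mul_mem hp (ht i)
  have h1 : IntermediateField.adjoin k (t : Set K) = ⊤ := by
    refine eq_top_iff.2 fun x _ => ?_
    obtain ⟨a, b, -, rfl⟩ := IsFractionRing.div_surjective (A := A) x
    obtain ⟨a, rfl⟩ := hg a
    obtain ⟨b, rfl⟩ := hg b
    exact div_mem (h0 a) (h0 b)
  have h2 : Algebra.IsAlgebraic (Algebra.adjoin k (t : Set K)) K := by
    refine ⟨fun x => ?_⟩
    have hx : x ∈ IntermediateField.adjoin k (t : Set K) := h1 ▸ IntermediateField.mem_top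
    obtain ⟨a, ha, b, hb, rfl⟩ := IntermediateField.mem_adjoin_iff_div.1 hx
    have h3 : ∀ c ∈ Algebra.adjoin k (t : Set K), IsAlgebraic (Algebra.adjoin k (t : Set K)) c :=
      fun c hc => isAlgebraic_algebraMap (⟨c, hc⟩ : Algebra.adjoin k (t : Set K))
    rw [div_eq_mul_inv]
    exact (h3 a ha).mul (h3 b hb).inv
  have h3 := Algebra.IsAlgebraic.trdeg_le_cardinalMk (R := k) (A := K) (s := (t : Set K))
  refine (trdeg_le_of_injective (IsScalarTower.toAlgHom k A K)
    (IsFractionRing.injective A K)).trans (h3.trans ?_)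
  simp

/-! ### Linear algebra in rank three with brackets and cross products. -/

section Bracket

/-- The determinant of three vectors of a rank three free module. -/
def bracket {R : Type*} [CommRing R] (a b c : Fin 3 → R) : R :=
  a 0 * (b 1 * c 2 - b 2 * c 1) + a 1 * (b 2 * c 0 - b 0 * c 2) + a 2 * (b 0 * c 1 - b 1 * c 0)

theorem bracket_swap_left {R : Type*} [CommRing R] (a b c : Fin 3 → R) :
    bracket b a c = -bracket a b c := by
  simp only [bracket]; ring

theorem bracket_rotate {R : Type*} [CommRing R] (a b c : Fin 3 → R) :
    bracket b c a = bracket a b c := by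
  simp only [bracket]; ring

theorem bracket_smul_add_smul {R : Type*} [CommRing R] (a b : Fin 3 → R) (x y : R) :
    bracket a b (x • a + y • b) = 0 := by
  simp only [bracket, Pi.add_apply, Pi.smul_apply, smul_eq_mul]; ring

theorem map_bracket {R S : Type*} [CommRing R] [CommRing S] (f : R →+* S) (a b c : Fin 3 → R) :
    bracket (f ∘ a) (f ∘ b) (f ∘ c) = f (bracket a b c) := by
  simp [bracket]

variable {K : Type*} [Field K]

theorem exists_smul_eq_of_cross_eq_zero {a b : Fin 3 → K} (ha : a ≠ 0) (h : a ⨯₃ b = 0) :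
    ∃ c : K, b = c • a := by
  obtain ⟨i, hi⟩ := Function.ne_iff.1 ha
  have h0 := congrFun h 0
  have h1 := congrFun h 1
  have h2 := congrFun h 2
  simp only [cross_apply, Matrix.cons_val, Pi.zero_apply] at h0 h1 h2 hi
  refine ⟨b i / a i, ?_⟩
  ext j
  rw [Pi.smul_apply, smul_eq_mul, div_mul_eq_mul_div, eq_div_iff hi]
  fin_cases i <;> fin_cases j <;> simp only [Fin.zero_eta, Fin.mk_one, Fin.reduceFinMk] <;> grind

theorem exists_smul_add_smul_eq {a b v : Fin 3 → K} (h : a ⨯₃ b ≠ 0) (hv : bracket a b v = 0) :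
    ∃ x y : K, v = x • a + y • b := by
  obtain ⟨i, hi⟩ := Function.ne_iff.1 h
  simp only [bracket] at hv
  fin_cases i
  · simp [cross_apply] at hi
    refine ⟨(v 1 * b 2 - v 2 * b 1) / (a 1 * b 2 - a 2 * b 1),
      (a 1 * v 2 - a 2 * v 1) / (a 1 * b 2 - a 2 * b 1), ?_⟩
    ext j
    simp only [Pi.add_apply, Pi.smul_apply, smul_eq_mul]
    field_simp
    fin_cases j <;> simp only [Fin.zero_eta, Fin.mk_one, Fin.reduceFinMk] <;> grind
  · simp [cross_apply] at hi
    refine ⟨(v 2 * b 0 - v 0 * b 2) / (a 2 * b 0 - a 0 * b 2),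
      (a 2 * v 0 - a 0 * v 2) / (a 2 * b 0 - a 0 * b 2), ?_⟩
    ext j
    simp only [Pi.add_apply, Pi.smul_apply, smul_eq_mul]
    field_simp
    fin_cases j <;> simp only [Fin.zero_eta, Fin.mk_one, Fin.reduceFinMk] <;> grind
  · simp [cross_apply] at hi
    refine ⟨(v 0 * b 1 - v 1 * b 0) / (a 0 * b 1 - a 1 * b 0),
      (a 0 * v 1 - a 1 * v 0) / (a 0 * b 1 - a 1 * b 0), ?_⟩
    ext j
    simp only [Pi.add_apply, Pi.smul_apply, smul_eq_mul]
    field_simp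
    fin_cases j <;> simp only [Fin.zero_eta, Fin.mk_one, Fin.reduceFinMk] <;> grind

/-- The vector lies in two distinct planes, hence on the line orthogonal to both normals. -/
theorem exists_smul_cross_eq {a b c d v : Fin 3 → K} (h : (a ⨯₃ b) ⨯₃ (c ⨯₃ d) ≠ 0)
    (h1 : bracket a b v = 0) (h2 : bracket c d v = 0) :
    ∃ m : K, v = m • ((a ⨯₃ b) ⨯₃ (c ⨯₃ d)) := by
  refine exists_smul_eq_of_cross_eq_zero h ?_
  simp only [bracket] at h1 h2
  ext j
  fin_cases j <;> simp [cross_apply] <;> grind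

theorem cross_eq_zero_symm {a b : Fin 3 → K} (h : a ⨯₃ b = 0) : b ⨯₃ a = 0 := by
  rw [← cross_anticomm, h, neg_zero]

theorem cross_eq_zero_trans {a b c : Fin 3 → K} (hb : b ≠ 0) (h1 : a ⨯₃ b = 0)
    (h2 : b ⨯₃ c = 0) : a ⨯₃ c = 0 := by
  obtain ⟨x, rfl⟩ := exists_smul_eq_of_cross_eq_zero hb (cross_eq_zero_symm h1)
  simp [h2]

end Bracket

/-! ### Counting the parameters of a configuration. -/

section DefinedBy

variable {k K : Type*} [Field k] [Field K] [Algebra k K]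

variable (k) in
/-- The coordinates of the vectors in `T` lie in an extension of `k` generated by `n` elements. -/
def DefinedBy (n : ℕ) (T : Set (Fin 3 → K)) : Prop :=
  ∃ t : Finset K, t.card ≤ n ∧ ∀ v ∈ T, ∀ j, v j ∈ IntermediateField.adjoin k (t : Set K)

namespace DefinedBy

variable {n : ℕ} {T : Set (Fin 3 → K)} {a b c d v : Fin 3 → K}

theorem empty : DefinedBy k 0 (∅ : Set (Fin 3 → K)) := ⟨∅, by simp, by simp⟩

theorem mono {m : ℕ} {T' : Set (Fin 3 → K)} (h : DefinedBy k n T) (hn : n ≤ m) (hT : T' ⊆ T) :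
    DefinedBy k m T' := by
  obtain ⟨t, ht, h⟩ := h
  exact ⟨t, ht.trans hn, fun v hv => h v (hT hv)⟩

theorem le {m : ℕ} (h : DefinedBy k n T) (hn : n ≤ m) : DefinedBy k m T := h.mono hn subset_rfl

theorem insert_of_adjoin (h : DefinedBy k n T) (s : Finset K)
    (hv : ∀ L : IntermediateField k K, (∀ x ∈ s, x ∈ L) → (∀ w ∈ T, ∀ j, w j ∈ L) → ∀ j, v j ∈ L) :
    DefinedBy k (n + s.card) (insert v T) := by
  classical
  obtain ⟨t, ht, h⟩ := h
  refine ⟨t ∪ s, (Finset.card_union_le _ _).trans (by omega), ?_⟩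
  have h1 : ∀ w ∈ T, ∀ j, w j ∈ IntermediateField.adjoin k ((t ∪ s : Finset K) : Set K) :=
    fun w hw j => IntermediateField.adjoin.mono k _ _ (by simp) (h w hw j)
  rintro w (rfl | hw)
  · exact hv _ (fun x hx => IntermediateField.subset_adjoin k _ (by simp [hx])) h1
  · exact h1 w hw

theorem free (h : DefinedBy k n T) (v : Fin 3 → K) : DefinedBy k (n + 3) (insert v T) := by
  classical
  refine (h.insert_of_adjoin (v := v) {v 0, v 1, v 2} ?_).le ?_
  · intro L hL _ j
    exact hL _ (by fin_cases j <;> simp)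
  · have := Finset.card_le_three (a := v 0) (b := v 1) (c := v 2)
    omega

theorem zero (h : DefinedBy k n T) (hv : v = 0) : DefinedBy k n (insert v T) := by
  refine h.insert_of_adjoin ∅ fun L _ _ j => ?_
  rw [hv]
  exact L.zero_mem

theorem smul (h : DefinedBy k n T) (ha : a ∈ T) (x : K) (hv : v = x • a) :
    DefinedBy k (n + 1) (insert v T) := by
  refine h.insert_of_adjoin {x} fun L hL hT j => ?_
  rw [hv]
  exact L.mul_mem (hL x (by simp)) (hT a ha j)

theorem smul_add_smul (h : DefinedBy k n T) (ha : a ∈ T) (hb : b ∈ T) (x y : K)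
    (hv : v = x • a + y • b) : DefinedBy k (n + 2) (insert v T) := by
  classical
  refine (h.insert_of_adjoin (v := v) {x, y} fun L hL hT j => ?_).le
    (by have := Finset.card_le_two (a := x) (b := y); omega)
  rw [hv]
  exact L.add_mem (L.mul_mem (hL x (by simp)) (hT a ha j)) (L.mul_mem (hL y (by simp)) (hT b hb j))

theorem cross (h : DefinedBy k n T) (ha : a ∈ T) (hb : b ∈ T) :
    DefinedBy k n (insert (a ⨯₃ b) T) := by
  refine h.insert_of_adjoin ∅ fun L _ hT j => ?_
  have h' : ∀ i j, a i * b j ∈ L := fun i j => L.mul_mem (hT a ha i) (hT b hb j)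
  fin_cases j <;> simp only [cross_apply, Matrix.cons_val, Fin.zero_eta, Fin.mk_one,
    Fin.reduceFinMk] <;> exact L.sub_mem (h' _ _) (h' _ _)

theorem parallel (h : DefinedBy k n T) (ha : a ∈ T) (ha0 : a ≠ 0) (hv : a ⨯₃ v = 0) :
    DefinedBy k (n + 1) (insert v T) := by
  obtain ⟨x, hx⟩ := exists_smul_eq_of_cross_eq_zero ha0 hv
  exact h.smul ha x hx

theorem span (h : DefinedBy k n T) (ha : a ∈ T) (hb : b ∈ T) (hab : a ⨯₃ b ≠ 0)
    (hv : bracket a b v = 0) : DefinedBy k (n + 2) (insert v T) := by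
  obtain ⟨x, y, hx⟩ := exists_smul_add_smul_eq hab hv
  exact h.smul_add_smul ha hb x y hx

/-- Cross products of known vectors are free of charge, so only the scalar along the intersection
line counts; the auxiliary normals are dropped at the end. -/
theorem meet (h : DefinedBy k n T) (ha : a ∈ T) (hb : b ∈ T) (hc : c ∈ T) (hd : d ∈ T)
    (hne : (a ⨯₃ b) ⨯₃ (c ⨯₃ d) ≠ 0) (h1 : bracket a b v = 0) (h2 : bracket c d v = 0) :
    DefinedBy k (n + 1) (insert v T) := by
  obtain ⟨m, hm⟩ := exists_smul_cross_eq hne h1 h2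
  refine ((((h.cross ha hb).cross (mem_insert_of_mem _ hc) (mem_insert_of_mem _ hd)).cross
    (mem_insert_of_mem _ (mem_insert _ _)) (mem_insert _ _)).smul (mem_insert _ _) m hm).mono
    le_rfl (insert_subset_insert ?_)
  intro x hx
  simp [hx]

end DefinedBy

/-- Bookkeeping along a path of vectors: either `T` is defined by `n + 1` elements and the last
vector `x` is not a multiple of the label `p` of the next edge, or `T` is defined by `n`
elements. -/
def PathBound (k : Type*) {K : Type*} [Field k] [Field K] [Algebra k K] (n : ℕ)
    (T : Set (Fin 3 → K)) (x p : Fin 3 → K) : Prop :=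
  (DefinedBy k (n + 1) T ∧ x ⨯₃ p ≠ 0) ∨ DefinedBy k n T

variable {n : ℕ} {T : Set (Fin 3 → K)} {x p y q : Fin 3 → K}

theorem PathBound.definedBy (h : PathBound k n T x p) : DefinedBy k (n + 1) T := by
  rcases h with h | h
  · exact h.1
  · exact h.le (Nat.le_succ n)

theorem DefinedBy.pathBound (h : DefinedBy k n T) (hq : q ∈ T) (hq0 : q ≠ 0) (y : Fin 3 → K) :
    PathBound k (n + 2) (insert y T) y q := by
  by_cases hy : y ⨯₃ q = 0
  · exact Or.inr ((h.parallel hq hq0 (cross_eq_zero_symm hy)).le (by omega))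
  · exact Or.inl ⟨h.free y, hy⟩

/-- An amortized count. If `x` is not a multiple of `p`, then `y` is in the span of both and costs
two. If it is, `y` may cost three, but one was saved at `x`. A `y` parallel to the next label costs
one and passes the saving on. -/
theorem PathBound.step (h : PathBound k n T x p) (hx : x ∈ T) (hp : p ∈ T) (hq : q ∈ T)
    (hq0 : q ≠ 0) (hy : bracket x y p = 0) : PathBound k (n + 2) (insert y T) y q := by
  rcases h with ⟨h, hxp⟩ | h
  · by_cases hy' : y ⨯₃ q = 0
    · exact Or.inr (h.parallel hq hq0 (cross_eq_zero_symm hy'))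
    · refine Or.inl ⟨h.span hx hp hxp ?_, hy'⟩
      rw [← neg_eq_zero, ← bracket_swap_left]
      rwa [bracket_rotate] at hy
  · exact h.pathBound hq hq0 y

end DefinedBy

/-! ### Polynomial parametrizations of the components. -/

section Parametrizations

variable {R S : Type*} [CommRing R] [CommRing S]

/-- A parametrization of the realizations of the Pascal configuration. -/
def pascalParam (a : Fin 20 → R) : Fin 9 → Fin 3 → R :=
  let p7 : Fin 3 → R := ![a 0, a 1, a 2]
  let p8 : Fin 3 → R := ![a 3, a 4, a 5]
  let p1 : Fin 3 → R := ![a 6, a 7, a 8]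
  let p9 := a 9 • p7 + a 10 • p8
  let p5 := a 11 • p1 + a 12 • p7
  let p6 := a 13 • p1 + a 14 • p8
  let p2 := a 15 • p6 + a 16 • p9
  let p3 := a 17 • p5 + a 18 • p9
  let p4 := a 19 • ((p2 ⨯₃ p7) ⨯₃ (p3 ⨯₃ p8))
  ![p9, p1, p2, p3, p4, p5, p6, p7, p8]

/-- A parametrization of the collections of `d` vectors in a plane. -/
def planeParam {d : ℕ} (a : Fin 6 ⊕ Fin d × Fin 2 → R) : Fin d → Fin 3 → R := fun i =>
  a (Sum.inr (i, 0)) • ![a (Sum.inl 0), a (Sum.inl 1), a (Sum.inl 2)] +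
    a (Sum.inr (i, 1)) • ![a (Sum.inl 3), a (Sum.inl 4), a (Sum.inl 5)]

/-- Four vectors and, after each of them, a combination of it and of the next one in the cyclic
order; the last of the nine vectors is zero. -/
def quadParam (a : Fin 20 → R) : Fin 9 → Fin 3 → R :=
  let w0 : Fin 3 → R := ![a 0, a 1, a 2]
  let w1 : Fin 3 → R := ![a 3, a 4, a 5]
  let w2 : Fin 3 → R := ![a 6, a 7, a 8]
  let w3 : Fin 3 → R := ![a 9, a 10, a 11]
  ![w0, a 12 • w0 + a 13 • w1, w1, a 14 • w1 + a 15 • w2, w2, a 16 • w2 + a 17 • w3,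
    w3, a 18 • w3 + a 19 • w0, 0]

theorem map_comp_cross (f : R →+* S) (a b : Fin 3 → R) : f ∘ (a ⨯₃ b) = (f ∘ a) ⨯₃ (f ∘ b) := by
  ext j
  fin_cases j <;> simp [cross_apply]

theorem map_comp_smul (f : R →+* S) (c : R) (a : Fin 3 → R) : f ∘ (c • a) = f c • (f ∘ a) := by
  ext j
  simp

theorem map_comp_vec (f : R →+* S) (a b c : R) : f ∘ ![a, b, c] = ![f a, f b, f c] := by
  ext j
  fin_cases j <;> simp

theorem pascalParam_map (f : R →+* S) (a : Fin 20 → R) (i : Fin 9) :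
    pascalParam (f ∘ a) i = f ∘ pascalParam a i := by
  fin_cases i <;> simp [pascalParam, map_comp_cross, map_comp_smul, map_comp_vec]

theorem planeParam_map {d : ℕ} (f : R →+* S) (a : Fin 6 ⊕ Fin d × Fin 2 → R) (i : Fin d) :
    planeParam (f ∘ a) i = f ∘ planeParam a i := by
  simp [planeParam, map_comp_vec]

theorem quadParam_map (f : R →+* S) (a : Fin 20 → R) (i : Fin 9) :
    quadParam (f ∘ a) i = f ∘ quadParam a i := by
  fin_cases i <;> simp [quadParam, map_comp_vec]

/-- The seven collinearities of the Pascal configuration. -/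
structure PascalIncidence (v : Fin 9 → Fin 3 → R) : Prop where
  l168 : bracket (v 1) (v 6) (v 8) = 0
  l157 : bracket (v 1) (v 5) (v 7) = 0
  l247 : bracket (v 2) (v 4) (v 7) = 0
  l269 : bracket (v 2) (v 6) (v 9) = 0
  l348 : bracket (v 3) (v 4) (v 8) = 0
  l359 : bracket (v 3) (v 5) (v 9) = 0
  l789 : bracket (v 7) (v 8) (v 9) = 0

theorem bracket_smul_cross_left (a b c d : Fin 3 → R) (m : R) :
    bracket a (m • ((a ⨯₃ b) ⨯₃ (c ⨯₃ d))) b = 0 := by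
  simp only [bracket, cross_apply, Matrix.cons_val, Pi.smul_apply, smul_eq_mul]; ring

theorem bracket_smul_cross_right (a b c d : Fin 3 → R) (m : R) :
    bracket c (m • ((a ⨯₃ b) ⨯₃ (c ⨯₃ d))) d = 0 := by
  simp only [bracket, cross_apply, Matrix.cons_val, Pi.smul_apply, smul_eq_mul]; ring

theorem bracket_smul_add_smul_mid (a b : Fin 3 → R) (x y : R) :
    bracket a (x • a + y • b) b = 0 := by
  simp only [bracket, Pi.add_apply, Pi.smul_apply, smul_eq_mul]; ring

theorem bracket_smul_add_smul_left (a b : Fin 3 → R) (x y : R) :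
    bracket (x • a + y • b) a b = 0 := by
  simp only [bracket, Pi.add_apply, Pi.smul_apply, smul_eq_mul]; ring

theorem pascalIncidence_pascalParam (a : Fin 20 → R) : PascalIncidence (pascalParam a) where
  l168 := bracket_smul_add_smul_mid _ _ _ _
  l157 := bracket_smul_add_smul_mid _ _ _ _
  l247 := bracket_smul_cross_left _ _ _ _ _
  l269 := bracket_smul_add_smul_left _ _ _ _
  l348 := bracket_smul_cross_right _ _ _ _ _
  l359 := bracket_smul_add_smul_left _ _ _ _
  l789 := bracket_smul_add_smul _ _ _ _

end Parametrizations

/-! ### Solving for the parameters of a nondegenerate configuration. -/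

section Existence

variable {K : Type*} [Field K]

theorem vec_eta {R : Type*} (v : Fin 3 → R) : ![v 0, v 1, v 2] = v := by
  ext j
  fin_cases j <;> rfl

theorem bracket_eq_zero_mid {R : Type*} [CommRing R] {a b c : Fin 3 → R}
    (h : bracket a b c = 0) : bracket a c b = 0 := by
  simp only [bracket] at h ⊢
  linear_combination -h

theorem bracket_eq_zero_rotate {R : Type*} [CommRing R] {a b c : Fin 3 → R}
    (h : bracket a b c = 0) : bracket b c a = 0 := by
  rw [bracket_rotate, h]

theorem bracket_eq_zero_swap {R : Type*} [CommRing R] {a b c : Fin 3 → R}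
    (h : bracket a b c = 0) : bracket b a c = 0 := by
  rw [bracket_swap_left, h, neg_zero]

/-- The points 9, 5, 6, 2, 3, 4 are solved for in this order; each nonvanishing hypothesis says that
the two vectors, or the two planes, determining the next point are independent. -/
theorem exists_pascalParam {v : Fin 9 → Fin 3 → K} (h : PascalIncidence v)
    (h78 : v 7 ⨯₃ v 8 ≠ 0) (h17 : v 1 ⨯₃ v 7 ≠ 0) (h18 : v 1 ⨯₃ v 8 ≠ 0) (h69 : v 6 ⨯₃ v 9 ≠ 0)
    (h59 : v 5 ⨯₃ v 9 ≠ 0) (h4 : (v 2 ⨯₃ v 7) ⨯₃ (v 3 ⨯₃ v 8) ≠ 0) :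
    ∃ a, pascalParam a = v := by
  obtain ⟨a9, a10, e9⟩ := exists_smul_add_smul_eq h78 h.l789
  obtain ⟨a11, a12, e5⟩ := exists_smul_add_smul_eq h17 (bracket_eq_zero_mid h.l157)
  obtain ⟨a13, a14, e6⟩ := exists_smul_add_smul_eq h18 (bracket_eq_zero_mid h.l168)
  obtain ⟨a15, a16, e2⟩ := exists_smul_add_smul_eq h69 (bracket_eq_zero_rotate h.l269)
  obtain ⟨a17, a18, e3⟩ := exists_smul_add_smul_eq h59 (bracket_eq_zero_rotate h.l359)
  obtain ⟨a19, e4⟩ := exists_smul_cross_eq h4 (bracket_eq_zero_mid h.l247)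
    (bracket_eq_zero_mid h.l348)
  refine ⟨![v 7 0, v 7 1, v 7 2, v 8 0, v 8 1, v 8 2, v 1 0, v 1 1, v 1 2, a9, a10, a11, a12, a13,
    a14, a15, a16, a17, a18, a19], ?_⟩
  funext i
  fin_cases i <;>
    simp only [pascalParam, Matrix.cons_val, vec_eta, ← e9, ← e5, ← e6, ← e2, ← e3, ← e4,
      Fin.zero_eta, Fin.mk_one, Fin.reduceFinMk]
  rfl

theorem exists_planeParam {d : ℕ} {v : Fin d → Fin 3 → K} {p q : Fin 3 → K} (hpq : p ⨯₃ q ≠ 0)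
    (h : ∀ i, bracket p q (v i) = 0) : ∃ a, planeParam a = v := by
  choose x y hxy using fun i => exists_smul_add_smul_eq hpq (h i)
  refine ⟨Sum.elim ![p 0, p 1, p 2, q 0, q 1, q 2] (fun ij => ![x ij.1, y ij.1] ij.2), ?_⟩
  funext i
  rw [hxy i]
  simp [planeParam, vec_eta]

/-- The vectors `w 0, w 2, w 4, w 6` form a cycle of length four, `w 1, w 3, w 5, w 7` are on its
sides, and `w 8` is zero. -/
structure QuadIncidence {R : Type*} [CommRing R] (w : Fin 9 → Fin 3 → R) : Prop where
  l01 : bracket (w 0) (w 2) (w 1) = 0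
  l12 : bracket (w 2) (w 4) (w 3) = 0
  l23 : bracket (w 4) (w 6) (w 5) = 0
  l30 : bracket (w 6) (w 0) (w 7) = 0
  zero : w 8 = 0

theorem quadIncidence_quadParam {R : Type*} [CommRing R] (a : Fin 20 → R) :
    QuadIncidence (quadParam a) where
  l01 := bracket_smul_add_smul _ _ _ _
  l12 := bracket_smul_add_smul _ _ _ _
  l23 := bracket_smul_add_smul _ _ _ _
  l30 := bracket_smul_add_smul _ _ _ _
  zero := rfl

theorem exists_quadParam {w : Fin 9 → Fin 3 → K} (h : QuadIncidence w)
    (h01 : w 0 ⨯₃ w 2 ≠ 0) (h12 : w 2 ⨯₃ w 4 ≠ 0) (h23 : w 4 ⨯₃ w 6 ≠ 0) (h30 : w 6 ⨯₃ w 0 ≠ 0) :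
    ∃ a, quadParam a = w := by
  obtain ⟨x0, y0, e0⟩ := exists_smul_add_smul_eq h01 h.l01
  obtain ⟨x1, y1, e1⟩ := exists_smul_add_smul_eq h12 h.l12
  obtain ⟨x2, y2, e2⟩ := exists_smul_add_smul_eq h23 h.l23
  obtain ⟨x3, y3, e3⟩ := exists_smul_add_smul_eq h30 h.l30
  refine ⟨![w 0 0, w 0 1, w 0 2, w 2 0, w 2 1, w 2 2, w 4 0, w 4 1, w 4 2, w 6 0, w 6 1, w 6 2,
    x0, y0, x1, y1, x2, y2, x3, y3], ?_⟩
  funext i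
  fin_cases i <;>
    simp only [quadParam, Matrix.cons_val, vec_eta, ← e0, ← e1, ← e2, ← e3,
      Fin.zero_eta, Fin.mk_one, Fin.reduceFinMk]
  exact h.zero.symm

end Existence

/-! ### Classification of the configurations with the seven collinearities. -/

section Classification

variable {k K : Type*} [Field k] [Field K] [Algebra k K]

namespace DefinedBy

variable {n : ℕ} {T : Set (Fin 3 → K)} {a b m w0 w1 w2 w3 m0 m1 m2 m3 : Fin 3 → K}

theorem pair_of_parallel (h : DefinedBy k n T) (ha : a ∈ T) (ha0 : a ≠ 0) (hab : a ⨯₃ b = 0) :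
    DefinedBy k (n + 4) (insert m (insert b T)) :=
  (h.parallel ha ha0 hab).free m

theorem pair (h : DefinedBy k n T) (ha : a ∈ T) (ha0 : a ≠ 0) (hm : bracket a b m = 0) :
    DefinedBy k (n + 5) (insert m (insert b T)) := by
  by_cases hab : a ⨯₃ b = 0
  · exact (h.pair_of_parallel ha ha0 hab).le (by omega)
  · exact (h.free b).span (mem_insert_of_mem _ ha) (mem_insert _ _) hab hm

/-- `m0` and `m3` are free: 6. The pairs `w1, m1` and `w3, m2` cost 5 each once `w2` (3) is nonzero,
in total 19; if `w2 = 0`, four free vectors give 18. -/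
theorem quad_of_eq_zero (h0 : w0 = 0) (h1 : bracket w1 w2 m1 = 0) (h2 : bracket w2 w3 m2 = 0) :
    DefinedBy k 19 ({w0, w1, w2, w3, m0, m1, m2, m3} : Set (Fin 3 → K)) := by
  have h := (((empty (k := k) (K := K)).zero h0).free m0).free m3
  by_cases hw2 : w2 = 0
  · refine (((((h.zero hw2).free w1).free w3).free m1).free m2).mono (by omega) ?_
    intro x hx
    simp only [mem_insert_iff, mem_singleton_iff, mem_empty_iff_false] at hx ⊢
    tauto
  · refine (((h.free w2).pair (mem_insert _ _) hw2
      (bracket_eq_zero_swap h1)).pair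
      (a := w2) (by simp) hw2 h2).mono (by omega) ?_
    intro x hx
    simp only [mem_insert_iff, mem_singleton_iff, mem_empty_iff_false] at hx ⊢
    tauto

/-- The count is `3 + 4` for `w0, w1, m0`, then 5 for `w3, m3`, then 7 for `w2, m1, m2`: either `3 +
2 + 2`, or `1 + 3 + 3` if `w2` is parallel to a neighbour. -/
theorem quad_of_parallel (hw0 : w0 ≠ 0) (hw1 : w1 ≠ 0) (hw3 : w3 ≠ 0) (h01 : w0 ⨯₃ w1 = 0)
    (h1 : bracket w1 w2 m1 = 0) (h2 : bracket w2 w3 m2 = 0) (h3 : bracket w3 w0 m3 = 0) :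
    DefinedBy k 19 ({w0, w1, w2, w3, m0, m1, m2, m3} : Set (Fin 3 → K)) := by
  have h := ((((empty (k := k) (K := K)).free w0).pair_of_parallel (m := m0) (mem_insert _ _)
    hw0 h01).pair (a := w0) (b := w3) (m := m3) (by simp) hw0 (bracket_eq_zero_swap h3))
  have hsub : ({w0, w1, w2, w3, m0, m1, m2, m3} : Set (Fin 3 → K)) ⊆
      insert m1 (insert m2 (insert w2 (insert m3 (insert w3 (insert m0 (insert w1
        (insert w0 ∅))))))) := by
    intro x hx
    simp only [mem_insert_iff, mem_singleton_iff, mem_empty_iff_false] at hx ⊢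
    tauto
  by_cases h12 : w1 ⨯₃ w2 = 0
  · exact (((h.parallel (by simp) hw1 h12).free m2).free m1).mono (by omega) hsub
  by_cases h23 : w3 ⨯₃ w2 = 0
  · exact (((h.parallel (by simp) hw3 h23).free m2).free m1).mono (by omega) hsub
  · exact (((h.free w2).span (a := w2) (b := w3) (by simp) (by simp)
      (fun h => h23 (cross_eq_zero_symm h)) h2).span (a := w1) (b := w2) (by simp) (by simp)
      h12 h1).mono (by omega) hsub

end DefinedBy

theorem exists_quadParam_or_definedBy {w : Fin 9 → Fin 3 → K} (h : QuadIncidence w) :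
    (∃ a, quadParam a = w) ∨ DefinedBy k 19 (range w) := by
  by_contra! hcon
  obtain ⟨hp, hd⟩ := hcon
  have hd' : ¬ DefinedBy k 19
      ({w 0, w 2, w 4, w 6, w 1, w 3, w 5, w 7} : Set (Fin 3 → K)) := by
    intro h'
    refine hd ((h'.zero h.zero).mono le_rfl ?_)
    rintro _ ⟨i, rfl⟩
    fin_cases i <;> simp
  have hrot : ({w 0, w 2, w 4, w 6, w 1, w 3, w 5, w 7} : Set (Fin 3 → K)) =
      {w 2, w 4, w 6, w 0, w 3, w 5, w 7, w 1} := by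
    ext x; simp only [mem_insert_iff, mem_singleton_iff]; tauto
  have hrot2 : ({w 0, w 2, w 4, w 6, w 1, w 3, w 5, w 7} : Set (Fin 3 → K)) =
      {w 4, w 6, w 0, w 2, w 5, w 7, w 1, w 3} := by
    ext x; simp only [mem_insert_iff, mem_singleton_iff]; tauto
  have hrot3 : ({w 0, w 2, w 4, w 6, w 1, w 3, w 5, w 7} : Set (Fin 3 → K)) =
      {w 6, w 0, w 2, w 4, w 7, w 1, w 3, w 5} := by
    ext x; simp only [mem_insert_iff, mem_singleton_iff]; tauto
  have z0 : w 0 ≠ 0 := fun h0 => hd' (.quad_of_eq_zero h0 h.l12 h.l23)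
  have z2 : w 2 ≠ 0 := fun h0 => hd' (hrot ▸ .quad_of_eq_zero h0 h.l23 h.l30)
  have z4 : w 4 ≠ 0 := fun h0 => hd' (hrot2 ▸ .quad_of_eq_zero h0 h.l30 h.l01)
  have z6 : w 6 ≠ 0 := fun h0 => hd' (hrot3 ▸ .quad_of_eq_zero h0 h.l01 h.l12)
  obtain ⟨a, ha⟩ := exists_quadParam h
    (fun h0 => hd' (.quad_of_parallel z0 z2 z6 h0 h.l12 h.l23 h.l30))
    (fun h0 => hd' (hrot ▸ .quad_of_parallel z2 z4 z0 h0 h.l23 h.l30 h.l01))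
    (fun h0 => hd' (hrot2 ▸ .quad_of_parallel z4 z6 z2 h0 h.l30 h.l01 h.l12))
    (fun h0 => hd' (hrot3 ▸ .quad_of_parallel z6 z0 z4 h0 h.l01 h.l12 h.l23))
  exact hp a ha

theorem PathBound.definedBy_of_path {n : ℕ} {T : Set (Fin 3 → K)}
    {p q r x0 x1 x2 x3 x4 x5 : Fin 3 → K} (h : PathBound k n T x0 p) (hx0 : x0 ∈ T) (hpT : p ∈ T)
    (hqT : q ∈ T) (hrT : r ∈ T) (hp : p ≠ 0) (hq : q ≠ 0) (hr : r ≠ 0) (h1 : bracket x0 x1 p = 0)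
    (h2 : bracket x1 x2 q = 0) (h3 : bracket x2 x3 r = 0) (h4 : bracket x3 x4 p = 0)
    (h5 : bracket x4 x5 q = 0) :
    DefinedBy k (n + 11) (insert x5 (insert x4 (insert x3 (insert x2 (insert x1 T))))) :=
  (((((h.step hx0 hpT hqT hq h1).step (by simp) (by simp [hqT]) (by simp [hrT]) hr h2).step
    (by simp) (by simp [hrT]) (by simp [hpT]) hp h3).step
    (by simp) (by simp [hpT]) (by simp [hqT]) hq h4).step
    (by simp) (by simp [hqT]) (by simp [hrT]) hr h5).definedBy

/-- A hexagon with sides labelled cyclically by the nonzero vectors `p, q, r, p, q, r`, each label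
being coplanar with the corresponding side, that is not defined by few elements. -/
structure GenericHexagon (k : Type*) {K : Type*} [Field k] [Field K] [Algebra k K]
    (p q r x0 x1 x2 x3 x4 x5 : Fin 3 → K) : Prop where
  s0 : bracket x0 x1 p = 0
  s1 : bracket x1 x2 q = 0
  s2 : bracket x2 x3 r = 0
  s3 : bracket x3 x4 p = 0
  s4 : bracket x4 x5 q = 0
  s5 : bracket x5 x0 r = 0
  labels : bracket p q r = 0
  p_ne : p ≠ 0
  q_ne : q ≠ 0
  r_ne : r ≠ 0
  bound : (DefinedBy k 8 {p, q, r} ∧ p ⨯₃ q ≠ 0 ∧ q ⨯₃ r ≠ 0 ∧ r ⨯₃ p ≠ 0) ∨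
    DefinedBy k 7 {p, q, r}
  generic : ¬ DefinedBy k 19 {x0, x1, x2, x3, x4, x5, p, q, r}

namespace GenericHexagon

variable {p q r x0 x1 x2 x3 x4 x5 : Fin 3 → K}

/-- The labels have period three, so the hexagon has cyclic and reflection symmetries; facts about
`x0` then transfer to every vertex. -/
theorem rotate (h : GenericHexagon k p q r x0 x1 x2 x3 x4 x5) :
    GenericHexagon k q r p x1 x2 x3 x4 x5 x0 where
  s0 := h.s1
  s1 := h.s2
  s2 := h.s3
  s3 := h.s4
  s4 := h.s5
  s5 := h.s0
  labels := bracket_eq_zero_rotate h.labels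
  p_ne := h.q_ne
  q_ne := h.r_ne
  r_ne := h.p_ne
  bound := by
    rcases h.bound with ⟨h1, h2, h3, h4⟩ | h1
    · exact Or.inl ⟨h1.mono le_rfl (fun x hx => by simp at hx ⊢; tauto), h3, h4, h2⟩
    · exact Or.inr (h1.mono le_rfl (fun x hx => by simp at hx ⊢; tauto))
  generic := fun h1 => h.generic (h1.mono le_rfl (fun x hx => by simp at hx ⊢; tauto))

theorem reflect (h : GenericHexagon k p q r x0 x1 x2 x3 x4 x5) :
    GenericHexagon k r q p x0 x5 x4 x3 x2 x1 where
  s0 := bracket_eq_zero_swap h.s5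
  s1 := bracket_eq_zero_swap h.s4
  s2 := bracket_eq_zero_swap h.s3
  s3 := bracket_eq_zero_swap h.s2
  s4 := bracket_eq_zero_swap h.s1
  s5 := bracket_eq_zero_swap h.s0
  labels := bracket_eq_zero_swap (bracket_eq_zero_rotate h.labels)
  p_ne := h.r_ne
  q_ne := h.q_ne
  r_ne := h.p_ne
  bound := by
    rcases h.bound with ⟨h1, h2, h3, h4⟩ | h1
    · exact Or.inl ⟨h1.mono le_rfl (fun x hx => by simp at hx ⊢; tauto),
        fun h => h3 (cross_eq_zero_symm h), fun h => h2 (cross_eq_zero_symm h),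
        fun h => h4 (cross_eq_zero_symm h)⟩
    · exact Or.inr (h1.mono le_rfl (fun x hx => by simp at hx ⊢; tauto))
  generic := fun h1 => h.generic (h1.mono le_rfl (fun x hx => by simp at hx ⊢; tauto))

/-- A vertex parallel to its label costs one instead of three. Starting the path there gives the
bound `8 + 11 = 19`, against genericity. -/
theorem cross_ne_zero (h : GenericHexagon k p q r x0 x1 x2 x3 x4 x5) : x0 ⨯₃ r ≠ 0 := by
  intro h0
  have hP : PathBound k 8 (insert x0 {p, q, r}) x0 p := by
    rcases h.bound with ⟨h1, -, -, h2⟩ | h1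
    · by_cases hx : x0 = 0
      · exact Or.inr (h1.zero hx)
      · refine Or.inl ⟨h1.parallel (a := r) (by simp) h.r_ne (cross_eq_zero_symm h0), fun h3 => ?_⟩
        exact h2 (cross_eq_zero_trans hx (cross_eq_zero_symm h0) h3)
    · exact Or.inr (h1.parallel (a := r) (by simp) h.r_ne (cross_eq_zero_symm h0))
  refine h.generic ((hP.definedBy_of_path (by simp) (by simp) (by simp) (by simp) h.p_ne h.q_ne
    h.r_ne h.s0 h.s1 h.s2 h.s3 h.s4).mono le_rfl (fun x hx => by simp at hx ⊢; tauto))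

theorem cross_ne_zero' (h : GenericHexagon k p q r x0 x1 x2 x3 x4 x5) : x0 ⨯₃ p ≠ 0 :=
  h.reflect.cross_ne_zero

theorem not_definedBy_five (h : GenericHexagon k p q r x0 x1 x2 x3 x4 x5) :
    ¬ DefinedBy k 5 {p, q, r} := by
  intro h1
  refine h.generic (((h1.pathBound (q := p) (by simp) h.p_ne x0).definedBy_of_path (by simp)
    (by simp) (by simp) (by simp) h.p_ne h.q_ne
    h.r_ne h.s0 h.s1 h.s2 h.s3 h.s4).mono (by omega) (fun x hx => by simp at hx ⊢; tauto))

/-- Dependent labels save one parameter. The path `x1, …, x5` avoids `x0`, which would be determined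
up to scale as a meet of two distinct planes. -/
theorem cross_cross_eq_zero (h : GenericHexagon k p q r x0 x1 x2 x3 x4 x5)
    (h7 : DefinedBy k 7 {p, q, r}) : (x1 ⨯₃ p) ⨯₃ (x5 ⨯₃ r) = 0 := by
  by_contra hne
  -- The path ends at `x5`, so its final label is an arbitrary nonzero one. The cost is `7 + 2 + 4 *
  -- 2 + 1 = 18`, and the meet adds one.
  have h1 := (((((h7.pathBound (q := q) (by simp) h.q_ne x1).step (y := x2) (q := r) (by simp)
    (by simp) (by simp) h.r_ne h.s1).step (y := x3) (q := p) (by simp)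
    (by simp) (by simp) h.p_ne h.s2).step (y := x4) (q := q) (by simp)
    (by simp) (by simp) h.q_ne h.s3).step (y := x5) (q := q) (by simp)
    (by simp) (by simp) h.q_ne h.s4).definedBy
  refine h.generic ((h1.meet (v := x0) (a := x1) (b := p) (c := x5) (d := r) (by simp) (by simp)
    (by simp) (by simp) hne ?_ ?_).mono (by omega) (fun x hx => by simp at hx ⊢; tauto))
  · exact bracket_eq_zero_mid (bracket_eq_zero_swap h.s0)
  · exact bracket_eq_zero_mid h.s5

theorem bracket_eq_zero_of_side {u v x y q : Fin 3 → K} (hx : bracket u v x = 0)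
    (hq : bracket u v q = 0) (hxq : x ⨯₃ q ≠ 0) (h : bracket x y q = 0) : bracket u v y = 0 := by
  obtain ⟨s, t, rfl⟩ := exists_smul_add_smul_eq hxq (bracket_eq_zero_mid h)
  simp only [bracket, Pi.add_apply, Pi.smul_apply, smul_eq_mul] at hx hq ⊢
  linear_combination s * hx + t * hq

/-- The planes of `x1, p` and of `x5, r` coincide, so they contain both labels. No vertex is
parallel to an adjacent label, so coplanarity spreads from side to side. The conclusion is empty
when `r` and `p` are parallel. -/
theorem coplanar (h : GenericHexagon k p q r x0 x1 x2 x3 x4 x5)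
    (h0 : (x1 ⨯₃ p) ⨯₃ (x5 ⨯₃ r) = 0) :
    ∀ y ∈ ({x0, x1, x2, x3, x4, x5, p, q, r} : Set (Fin 3 → K)), bracket r p y = 0 := by
  have n1 := h.rotate.cross_ne_zero
  have n5 := h.rotate.rotate.rotate.rotate.rotate.cross_ne_zero'
  obtain ⟨c, hc⟩ := exists_smul_eq_of_cross_eq_zero n1 h0
  obtain ⟨d, hd⟩ := exists_smul_eq_of_cross_eq_zero n5 (cross_eq_zero_symm h0)
  have hp : bracket r p p = 0 := by simp only [bracket]; ring
  have hr : bracket r p r = 0 := by simp only [bracket]; ring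
  have hq : bracket r p q = 0 := bracket_eq_zero_rotate (bracket_eq_zero_rotate h.labels)
  have hx1 : bracket r p x1 = 0 := by
    have e0 := congrFun hd 0
    have e1 := congrFun hd 1
    have e2 := congrFun hd 2
    simp only [cross_apply, Matrix.cons_val, Pi.smul_apply, smul_eq_mul] at e0 e1 e2
    simp only [bracket]
    linear_combination (-r 0) * e0 - r 1 * e1 - r 2 * e2
  have hx5 : bracket r p x5 = 0 := by
    have e0 := congrFun hc 0
    have e1 := congrFun hc 1
    have e2 := congrFun hc 2
    simp only [cross_apply, Matrix.cons_val, Pi.smul_apply, smul_eq_mul] at e0 e1 e2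
    simp only [bracket]
    linear_combination (p 0) * e0 + p 1 * e1 + p 2 * e2
  have hx0 := bracket_eq_zero_of_side hx1 hp n1 (bracket_eq_zero_swap h.s0)
  have hx2 := bracket_eq_zero_of_side hx1 hq h.rotate.cross_ne_zero' h.s1
  have hx3 := bracket_eq_zero_of_side hx2 hr h.rotate.rotate.cross_ne_zero' h.s2
  have hx4 := bracket_eq_zero_of_side hx3 hp h.rotate.rotate.rotate.cross_ne_zero' h.s3
  rintro y (rfl | rfl | rfl | rfl | rfl | rfl | rfl | rfl | rfl) <;> assumption

/-- Not all labels are parallel, since they would cost only 5; a suitable rotation makes the pair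
spanning the plane independent. -/
theorem exists_coplanar (h : GenericHexagon k p q r x0 x1 x2 x3 x4 x5)
    (h7 : DefinedBy k 7 {p, q, r}) : ∃ u v : Fin 3 → K, u ⨯₃ v ≠ 0 ∧
      ∀ y ∈ ({x0, x1, x2, x3, x4, x5, p, q, r} : Set (Fin 3 → K)), bracket u v y = 0 := by
  by_cases h1 : r ⨯₃ p = 0
  · by_cases h2 : p ⨯₃ q = 0
    · refine absurd ?_ h.not_definedBy_five
      refine ((((DefinedBy.empty (k := k) (K := K)).free p).parallel (v := q) (by simp) h.p_ne
        h2).parallel (v := r) (a := p) (by simp) h.p_ne (cross_eq_zero_symm h1)).mono le_rfl ?_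
      intro x hx
      simp at hx ⊢; tauto
    · refine ⟨p, q, h2, fun y hy => h.rotate.coplanar (h.rotate.cross_cross_eq_zero ?_) y ?_⟩
      · exact h7.mono le_rfl (fun x hx => by simp at hx ⊢; tauto)
      · simp at hy ⊢; tauto
  · exact ⟨r, p, h1, h.coplanar (h.cross_cross_eq_zero h7)⟩

end GenericHexagon

theorem definedBy_labels {p q r : Fin 3 → K} (hp : p ≠ 0) (hq : q ≠ 0) (h : bracket p q r = 0) :
    (DefinedBy k 8 {p, q, r} ∧ p ⨯₃ q ≠ 0 ∧ q ⨯₃ r ≠ 0 ∧ r ⨯₃ p ≠ 0) ∨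
      DefinedBy k 7 {p, q, r} := by
  have h0 := (DefinedBy.empty (k := k) (K := K)).free p
  by_cases h1 : p ⨯₃ q = 0
  · exact Or.inr (((h0.parallel (by simp) hp h1).free r).mono (by omega)
      (fun x hx => by simp at hx ⊢; tauto))
  by_cases h2 : q ⨯₃ r = 0
  · exact Or.inr (((h0.free q).parallel (by simp) hq h2).mono (by omega)
      (fun x hx => by simp at hx ⊢; tauto))
  by_cases h3 : r ⨯₃ p = 0
  · exact Or.inr (((h0.free q).parallel (a := p) (by simp) hp (cross_eq_zero_symm h3)).mono
      (by omega) (fun x hx => by simp at hx ⊢; tauto))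
  · exact Or.inl ⟨((h0.free q).span (a := p) (b := q) (by simp) (by simp) h1 h).mono (by omega)
      (fun x hx => by simp at hx ⊢; tauto), h1, h2, h3⟩

/-- For each of the points `7`, `8`, `9`, the order in which the other points appear on the
quadrilateral formed by the lines that avoid this point, followed by the point itself. -/
def quadOrder : Fin 3 → Fin 9 → Fin 9 :=
  ![![6, 1, 8, 4, 3, 5, 9, 2, 7], ![7, 1, 5, 3, 9, 6, 2, 4, 8], ![8, 6, 1, 5, 7, 2, 4, 3, 9]]

theorem PascalIncidence.quadIncidence {v : Fin 9 → Fin 3 → K} (h : PascalIncidence v) {j : Fin 3}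
    (hj : v (quadOrder j 8) = 0) : QuadIncidence (v ∘ quadOrder j) := by
  fin_cases j
  · exact ⟨bracket_eq_zero_rotate h.l168, bracket_eq_zero_rotate (bracket_eq_zero_rotate h.l348),
      bracket_eq_zero_mid h.l359, bracket_eq_zero_swap (bracket_eq_zero_rotate h.l269), hj⟩
  · exact ⟨bracket_eq_zero_swap (bracket_eq_zero_rotate h.l157), bracket_eq_zero_rotate h.l359,
      bracket_eq_zero_rotate (bracket_eq_zero_rotate h.l269), bracket_eq_zero_mid h.l247, hj⟩
  · exact ⟨bracket_eq_zero_rotate (bracket_eq_zero_rotate h.l168), bracket_eq_zero_mid h.l157,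
      bracket_eq_zero_swap (bracket_eq_zero_rotate h.l247), bracket_eq_zero_rotate h.l348, hj⟩

theorem quadOrder_surjective : ∀ j, Function.Surjective (quadOrder j) := by
  decide +kernel

theorem PascalIncidence.classification {v : Fin 9 → Fin 3 → K} (h : PascalIncidence v) :
    (∃ a, pascalParam a = v) ∨ (∃ a, planeParam a = v) ∨
      (∃ j a, quadParam a = v ∘ quadOrder j) ∨ DefinedBy k 19 (range v) := by
  by_contra! hcon
  obtain ⟨hA, hB, hC, hD⟩ := hcon
  have hz : ∀ j, v (quadOrder j 8) ≠ 0 := by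
    intro j hj
    rcases exists_quadParam_or_definedBy (k := k) (h.quadIncidence hj) with ⟨a, ha⟩ | h1
    · exact hC j a ha
    · refine hD (h1.mono le_rfl ?_)
      rintro _ ⟨i, rfl⟩
      obtain ⟨i, rfl⟩ := quadOrder_surjective j i
      exact ⟨i, rfl⟩
  have h7 : v 7 ≠ 0 := hz 0
  have h8 : v 8 ≠ 0 := hz 1
  have h9 : v 9 ≠ 0 := hz 2
  have hmem : ∀ i, v i ∈ ({v 4, v 2, v 6, v 1, v 5, v 3, v 7, v 9, v 8} : Set (Fin 3 → K)) := by
    intro i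
    fin_cases i <;> simp
  -- The sides of the hexagon 4, 2, 6, 1, 5, 3 lie on 247, 269, 168, 157, 359, 348, and 789 makes
  -- the labels coplanar.
  have hG : GenericHexagon k (v 7) (v 9) (v 8) (v 4) (v 2) (v 6) (v 1) (v 5) (v 3) :=
    { s0 := bracket_eq_zero_swap h.l247
      s1 := h.l269
      s2 := bracket_eq_zero_swap h.l168
      s3 := h.l157
      s4 := bracket_eq_zero_swap h.l359
      s5 := h.l348
      labels := bracket_eq_zero_mid h.l789
      p_ne := h7
      q_ne := h9
      r_ne := h8
      bound := definedBy_labels h7 h9 (bracket_eq_zero_mid h.l789)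
      generic := fun h1 => hD (h1.mono le_rfl (by rintro _ ⟨i, rfl⟩; exact hmem i)) }
  have hcop : ¬ ∃ u w : Fin 3 → K, u ⨯₃ w ≠ 0 ∧ ∀ i, bracket u w (v i) = 0 := by
    rintro ⟨u, w, hne, h1⟩
    obtain ⟨a, ha⟩ := exists_planeParam hne h1
    exact hB a ha
  rcases hG.bound with ⟨-, -, -, h87⟩ | h1
  · by_cases h4 : (v 2 ⨯₃ v 7) ⨯₃ (v 3 ⨯₃ v 8) = 0
    · exact hcop ⟨v 8, v 7, h87, fun i => hG.coplanar h4 _ (hmem i)⟩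
    · obtain ⟨a, ha⟩ := exists_pascalParam h (fun h => h87 (cross_eq_zero_symm h))
        hG.rotate.rotate.rotate.cross_ne_zero' hG.rotate.rotate.rotate.cross_ne_zero
        hG.rotate.rotate.cross_ne_zero hG.rotate.rotate.rotate.rotate.cross_ne_zero' h4
      exact hA a ha
  · obtain ⟨u, w, hne, h2⟩ := hG.exists_coplanar h1
    exact hcop ⟨u, w, hne, fun i => h2 _ (hmem i)⟩

end Classification

/-! ### Closed sets, closures and irreducibility in the Zariski topology. -/

section Zariski

theorem isClosed_zariskiTopology_iff {σ : Type*} {Z : Set (σ → ℂ)} :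
    @IsClosed _ (zariskiTopology σ) Z ↔
      ∃ I : Ideal (MvPolynomial σ ℂ), Z = MvPolynomial.zeroLocus ℂ I := by
  let _ := zariskiTopology σ
  rw [← isOpen_compl_iff]
  change Zᶜᶜ ∈ {Z | ∃ I : Ideal (MvPolynomial σ ℂ), Z = MvPolynomial.zeroLocus ℂ I} ↔ _
  rw [compl_compl]
  rfl

theorem closure_zariskiTopology {σ : Type*} (S : Set (σ → ℂ)) :
    @closure _ (zariskiTopology σ) S =
      MvPolynomial.zeroLocus ℂ (MvPolynomial.vanishingIdeal ℂ S) := by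
  let _ := zariskiTopology σ
  apply subset_antisymm
  · exact closure_minimal (MvPolynomial.zeroLocus_vanishingIdeal_le S)
      (isClosed_zariskiTopology_iff.2 ⟨_, rfl⟩)
  · obtain ⟨I, hI⟩ := isClosed_zariskiTopology_iff.1 (isClosed_closure (s := S))
    rw [hI]
    refine MvPolynomial.zeroLocus_anti_mono ?_
    rw [← MvPolynomial.le_zeroLocus_iff_le_vanishingIdeal, ← hI]
    exact subset_closure

theorem isIrreducible_closure_zariskiTopology {σ : Type*} {S : Set (σ → ℂ)} (hne : S.Nonempty)
    (hS : (MvPolynomial.vanishingIdeal ℂ S).IsPrime) :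
    @IsIrreducible _ (zariskiTopology σ) (@closure _ (zariskiTopology σ) S) := by
  let _ := zariskiTopology σ
  refine IsIrreducible.closure ⟨hne, ?_⟩
  rw [isPreirreducible_iff_isClosed_union_isClosed]
  intro Z₁ Z₂ h₁ h₂ hsub
  obtain ⟨I, rfl⟩ := isClosed_zariskiTopology_iff.1 h₁
  obtain ⟨J, rfl⟩ := isClosed_zariskiTopology_iff.1 h₂
  rw [MvPolynomial.le_zeroLocus_iff_le_vanishingIdeal,
    MvPolynomial.le_zeroLocus_iff_le_vanishingIdeal, ← hS.mul_le]
  refine Ideal.mul_le.2 fun f hf g hg x hx => ?_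
  rw [map_mul]
  rcases hsub hx with h | h
  · rw [h f hf, zero_mul]
  · rw [h g hg, mul_zero]

end Zariski

/-! ### Parametrized matroid varieties. -/

section Parametrizes

variable {α : Type}

/-- Independence is an open condition: a left inverse `g` of the map given by `γ₀` turns it into a
determinant, equal to 1 at `γ₀`. -/
theorem exists_polynomial_linearIndepOn [Finite α] (γ₀ : α × Fin 3 → ℂ) (S : Set α)
    (h : LinearIndepOn ℂ (vec γ₀) S) :
    ∃ D : MvPolynomial (α × Fin 3) ℂ, MvPolynomial.eval γ₀ D ≠ 0 ∧
      ∀ γ, MvPolynomial.eval γ D ≠ 0 → LinearIndepOn ℂ (vec γ) S := by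
  classical
  have := Fintype.ofFinite S
  have hker : LinearMap.ker (Fintype.linearCombination ℂ (fun i : S => vec γ₀ i)) = ⊥ := by
    rw [LinearMap.ker_eq_bot]
    exact LinearIndependent.fintypeLinearCombination_injective h
  obtain ⟨g, hg⟩ := LinearMap.exists_leftInverse_of_injective _ hker
  let D : MvPolynomial (α × Fin 3) ℂ := Matrix.det (Matrix.of fun i j : S =>
    ∑ l, MvPolynomial.X ((i : α), l) * MvPolynomial.C (g (Pi.single l 1) j))
  have hev : ∀ γ : α × Fin 3 → ℂ, MvPolynomial.eval γ D =
      (Matrix.of fun i : S => g (vec γ i)).det := by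
    intro γ
    simp only [D]
    rw [RingHom.map_det]
    congr 1
    ext i j
    have : vec γ i = ∑ l, γ ((i : α), l) • (Pi.single l 1 : Fin 3 → ℂ) := by
      ext l
      simp [vec, Pi.single_apply]
    simp [this]
  refine ⟨D, ?_, fun γ hγ => ?_⟩
  rotate_left
  · rw [hev] at hγ
    have h1 := Matrix.linearIndependent_rows_of_det_ne_zero hγ
    exact LinearIndependent.of_comp g h1
  · rw [hev]
    have : (Matrix.of fun i : S => g (vec γ₀ i)) = 1 := by
      ext i j
      have h1 := LinearMap.congr_fun hg (Pi.single i 1)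
      simp only [LinearMap.comp_apply, Fintype.linearCombination_apply_single, one_smul,
        LinearMap.id_apply] at h1
      simp [h1, Matrix.one_apply, Pi.single_apply, eq_comm]
    simp [this]

variable {τ : Type}

/-- The polynomial map `Φ` parametrizes the realizations of `N`: its values have the dependencies
of `N`, one of them is a realization, and all realizations are values. -/
structure Parametrizes (N : Matroid α) (Φ : α → Fin 3 → MvPolynomial τ ℂ) : Prop where
  dep : ∀ a : τ → ℂ, ∀ S, N.Dep S →
    ¬ LinearIndepOn ℂ (fun i j => MvPolynomial.eval a (Φ i j)) S
  indep : ∃ a : τ → ℂ, ∀ S, N.Indep S →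
    LinearIndepOn ℂ (fun i j => MvPolynomial.eval a (Φ i j)) S
  surj : ∀ γ ∈ realizationSpace N, ∃ a : τ → ℂ, ∀ i j, γ (i, j) = MvPolynomial.eval a (Φ i j)

theorem mem_realizationSpace {N : Matroid α} {γ : α × Fin 3 → ℂ}
    (h1 : ∀ S, N.Dep S → ¬ LinearIndepOn ℂ (vec γ) S)
    (h2 : ∀ S, N.Indep S → LinearIndepOn ℂ (vec γ) S) : γ ∈ realizationSpace N := by
  intro S hS
  refine ⟨h1 S, fun h => ?_⟩
  rw [← Matroid.not_indep_iff hS]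
  exact fun h3 => h (h2 S h3)

namespace Parametrizes

variable {N : Matroid α} {Φ : α → Fin 3 → MvPolynomial τ ℂ}

/-- The parameters giving realizations contain a nonempty principal open set. The pullback of `f`
vanishes there, hence is zero because the polynomial ring is a domain. -/
theorem bind₁_eq_zero [Finite α] (h : Parametrizes N Φ) {f : MvPolynomial (α × Fin 3) ℂ}
    (hf : f ∈ MvPolynomial.vanishingIdeal ℂ (realizationSpace N)) :
    MvPolynomial.bind₁ (fun ij => Φ ij.1 ij.2) f = 0 := by
  classical
  have := Fintype.ofFinite (Set α)
  obtain ⟨a₀, ha₀⟩ := h.indep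
  have hev : ∀ (a : τ → ℂ) (p : MvPolynomial (α × Fin 3) ℂ),
      MvPolynomial.eval a (MvPolynomial.bind₁ (fun ij => Φ ij.1 ij.2) p) =
        MvPolynomial.eval (fun ij => MvPolynomial.eval a (Φ ij.1 ij.2)) p := by
    intro a p
    exact MvPolynomial.eval₂Hom_bind₁ _ _ _ _
  choose D hD hD' using fun S : {S // N.Indep S} =>
    exists_polynomial_linearIndepOn (fun ij => MvPolynomial.eval a₀ (Φ ij.1 ij.2)) S
      (ha₀ S S.2)
  have h1 : MvPolynomial.bind₁ (fun ij => Φ ij.1 ij.2) (f * ∏ S, D S) = 0 := by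
    refine MvPolynomial.funext fun a => ?_
    rw [hev, map_mul, map_zero]
    by_cases hz : MvPolynomial.eval (fun ij => MvPolynomial.eval a (Φ ij.1 ij.2)) (∏ S, D S) = 0
    · rw [hz, mul_zero]
    · rw [map_prod, ← ne_eq, Finset.prod_ne_zero_iff] at hz
      rw [mul_eq_zero]
      refine Or.inl (hf _ (mem_realizationSpace (h.dep a) fun S hS => ?_))
      exact hD' ⟨S, hS⟩ _ (hz _ (Finset.mem_univ _))
  rw [map_mul, mul_eq_zero] at h1
  refine h1.resolve_right fun h2 => ?_
  have h3 := hev a₀ (∏ S, D S)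
  rw [h2, map_zero, map_prod] at h3
  exact Finset.prod_ne_zero_iff.2 (fun S _ => hD S) h3.symm

theorem aeval_eq_zero [Finite α] (h : Parametrizes N Φ) {K : Type*} [Field K] [Algebra ℂ K]
    (a : τ → K)
    {f : MvPolynomial (α × Fin 3) ℂ}
    (hf : f ∈ MvPolynomial.vanishingIdeal ℂ (realizationSpace N)) :
    MvPolynomial.aeval (fun ij => MvPolynomial.aeval a (Φ ij.1 ij.2)) f = 0 := by
  have h1 := congrArg (MvPolynomial.aeval a) (h.bind₁_eq_zero hf)
  rwa [MvPolynomial.aeval_bind₁, map_zero] at h1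

theorem nonempty (h : Parametrizes N Φ) : (realizationSpace N).Nonempty := by
  obtain ⟨a, ha⟩ := h.indep
  exact ⟨fun ij => MvPolynomial.eval a (Φ ij.1 ij.2), mem_realizationSpace (h.dep a) ha⟩

theorem isPrime_vanishingIdeal [Finite α] (h : Parametrizes N Φ) :
    (MvPolynomial.vanishingIdeal ℂ (realizationSpace N)).IsPrime := by
  refine ⟨fun h1 => ?_, fun {f g} hfg => ?_⟩
  · obtain ⟨γ, hγ⟩ := h.nonempty
    have : (1 : MvPolynomial (α × Fin 3) ℂ) ∈
      MvPolynomial.vanishingIdeal ℂ (realizationSpace N) := h1 ▸ trivial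
    have := this γ hγ
    simp at this
  · have h1 := h.bind₁_eq_zero hfg
    have h2 : ∀ p : MvPolynomial (α × Fin 3) ℂ,
        MvPolynomial.bind₁ (fun ij => Φ ij.1 ij.2) p = 0 →
        p ∈ MvPolynomial.vanishingIdeal ℂ (realizationSpace N) := by
      intro p hp γ hγ
      obtain ⟨a, ha⟩ := h.surj γ hγ
      have h3 := congrArg (MvPolynomial.aeval a) hp
      rw [MvPolynomial.aeval_bind₁, map_zero] at h3
      have : γ = fun ij => MvPolynomial.aeval a (Φ ij.1 ij.2) := funext fun ij => by
        rw [MvPolynomial.aeval_eq_eval]; exact ha _ _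
      rwa [this]
    rw [map_mul, mul_eq_zero] at h1
    exact h1.imp (h2 f) (h2 g)

theorem isIrreducible [Finite α] (h : Parametrizes N Φ) :
    @IsIrreducible _ (zariskiTopology (α × Fin 3)) (matroidVariety N) :=
  isIrreducible_closure_zariskiTopology h.nonempty h.isPrime_vanishingIdeal

end Parametrizes

theorem not_matroidVariety_subset {N N' : Matroid α} {γ : α × Fin 3 → ℂ}
    (hγ : γ ∈ realizationSpace N) (f : MvPolynomial (α × Fin 3) ℂ)
    (hf : ∀ γ' ∈ realizationSpace N', MvPolynomial.aeval γ' f = 0)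
    (h : MvPolynomial.aeval γ f ≠ 0) : ¬ matroidVariety N ⊆ matroidVariety N' := by
  intro hsub
  simp only [matroidVariety, closure_zariskiTopology] at hsub
  exact h (hsub (MvPolynomial.zeroLocus_vanishingIdeal_le _ hγ) f hf)

theorem isClosed_matroidVariety (N : Matroid α) :
    @IsClosed _ (zariskiTopology (α × Fin 3)) (matroidVariety N) :=
  @isClosed_closure _ (zariskiTopology (α × Fin 3)) _

end Parametrizes

/-! ### Linear independence in terms of brackets and cross products. -/

section LinearIndependence

variable {α K : Type*} [Field K]

theorem bracket_eq_det {R : Type*} [CommRing R] (a b c : Fin 3 → R) :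
    bracket a b c = (Matrix.of ![a, b, c]).det := by
  rw [Matrix.det_fin_three]
  simp [bracket]
  ring

theorem linearIndependent_iff_bracket_ne_zero {a b c : Fin 3 → K} :
    LinearIndependent K ![a, b, c] ↔ bracket a b c ≠ 0 := by
  rw [bracket_eq_det]
  constructor
  · intro h
    have h1 := Matrix.linearIndependent_rows_iff_isUnit.1
      (show LinearIndependent K (Matrix.of ![a, b, c]).row from h)
    exact ((Matrix.isUnit_iff_isUnit_det _).1 h1).ne_zero
  · exact fun h => Matrix.linearIndependent_rows_of_det_ne_zero h

theorem linearIndepOn_of_bracket_ne_zero {v : α → Fin 3 → K} {i j l : α}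
    (h : bracket (v i) (v j) (v l) ≠ 0) : LinearIndepOn K v {i, j, l} := by
  rw [← linearIndependent_iff_bracket_ne_zero] at h
  have hc : ![v i, v j, v l] = v ∘ ![i, j, l] := by
    ext m n; fin_cases m <;> rfl
  rw [hc] at h
  have h1 := (linearIndepOn_range_iff h.injective.of_comp v).2 h
  refine h1.mono ?_
  rintro x (rfl | rfl | rfl)
  exacts [⟨0, rfl⟩, ⟨1, rfl⟩, ⟨2, rfl⟩]

theorem bracket_ne_zero_of_linearIndepOn {v : α → Fin 3 → K} {S : Set α} {i j l : α}
    (h : LinearIndepOn K v S) (hi : i ∈ S) (hj : j ∈ S) (hl : l ∈ S) (hij : i ≠ j) (hil : i ≠ l)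
    (hjl : j ≠ l) : bracket (v i) (v j) (v l) ≠ 0 := by
  rw [← linearIndependent_iff_bracket_ne_zero]
  have hc : ![v i, v j, v l] = (fun x : S => v x) ∘ ![⟨i, hi⟩, ⟨j, hj⟩, ⟨l, hl⟩] := by
    ext m n; fin_cases m <;> rfl
  rw [hc]
  refine LinearIndependent.comp h _ ?_
  intro m n hmn
  fin_cases m <;> fin_cases n <;> simp_all

theorem cross_ne_zero_of_linearIndepOn {v : α → Fin 3 → K} {S : Set α} {i j : α}
    (h : LinearIndepOn K v S) (hi : i ∈ S) (hj : j ∈ S) (hij : i ≠ j) : v i ⨯₃ v j ≠ 0 := by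
  intro h0
  have hi0 : v i ≠ 0 := h.ne_zero hi
  obtain ⟨c, hc⟩ := exists_smul_eq_of_cross_eq_zero hi0 h0
  have h1 := (LinearIndepOn.pair_iff v hij).1 (h.mono (show {i, j} ⊆ S by
    rintro x (rfl | rfl) <;> assumption)) c (-1) (by simp [hc])
  simp at h1

theorem linearIndepOn_pair_of_cross_ne_zero {v : α → Fin 3 → K} {i j : α}
    (h : v i ⨯₃ v j ≠ 0) : LinearIndepOn K v {i, j} := by
  have hij : i ≠ j := by rintro rfl; exact h (cross_self _)
  rw [LinearIndepOn.pair_iff v hij]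
  intro s t hst
  have h1 : s • (v i ⨯₃ v j) = 0 := by
    have := congrArg (fun w => w ⨯₃ v j) hst
    simpa using this
  have h2 : t • (v i ⨯₃ v j) = 0 := by
    have := congrArg (fun w => v i ⨯₃ w) hst
    simpa using this
  exact ⟨(smul_eq_zero.1 h1).resolve_right h, (smul_eq_zero.1 h2).resolve_right h⟩

end LinearIndependence

/-! ### The circuit equations and integral witnesses. -/

section Matroids

theorem pascal_indep_coe (S : Finset (Fin 9)) :
    pascal.Indep (S : Set (Fin 9)) ↔ S.card ≤ 3 ∧ S ∉ pascalLines := by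
  simp only [pascal, IndepMatroid.matroid_Indep, IndepMatroid.ofFinset_indep]

theorem pascal_ground : pascal.E = univ := rfl

theorem makeLoop_pascal_ground (i : Fin 9) : (makeLoop pascal i).E = univ := rfl

theorem uniformTwo_ground (d : ℕ) : (uniformTwo d).E = univ := rfl

theorem uniformTwo_indep_iff {d : ℕ} {S : Set (Fin d)} : (uniformTwo d).Indep S ↔ S.ncard ≤ 2 := by
  simp [uniformTwo, IndepMatroid.ofFinite]

theorem dep_iff_not_indep {α : Type*} {N : Matroid α} (hE : N.E = univ) {S : Set α} :
    N.Dep S ↔ ¬ N.Indep S :=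
  (Matroid.not_indep_iff (hE ▸ subset_univ S)).symm

theorem linearIndepOn_of_mem_realizationSpace {α : Type*} {N : Matroid α}
    {γ : α × Fin 3 → ℂ} (hγ : γ ∈ realizationSpace N) {S : Set α} (hS : N.Indep S) :
    LinearIndepOn ℂ (vec γ) S := by
  by_contra h
  exact ((hγ S hS.subset_ground).2 h).not_indep hS

theorem PascalIncidence.not_linearIndepOn {v : Fin 9 → Fin 3 → ℂ} (h : PascalIncidence v)
    {S : Set (Fin 9)} (hS : ¬ pascal.Indep S) : ¬ LinearIndepOn ℂ v S := by
  classical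
  intro hli
  obtain ⟨S, rfl⟩ : ∃ T : Finset (Fin 9), S = T := ⟨S.toFinset, by simp⟩
  have hcard : S.card ≤ 3 := by
    have := LinearIndependent.fintype_card_le_finrank hli
    simpa using this
  have hmem : S ∈ pascalLines := by
    by_contra h1
    exact hS ((pascal_indep_coe S).2 ⟨hcard, h1⟩)
  have key : ∀ i j l : Fin 9, S = {i, j, l} → i ≠ j → i ≠ l → j ≠ l →
      bracket (v i) (v j) (v l) ≠ 0 := by
    rintro i j l rfl hij hil hjl
    exact bracket_ne_zero_of_linearIndepOn hli (by simp) (by simp) (by simp) hij hil hjl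
  simp only [pascalLines, Finset.mem_insert, Finset.mem_singleton] at hmem
  rcases hmem with e | e | e | e | e | e | e
  · exact key _ _ _ e (by decide) (by decide) (by decide) h.l168
  · exact key _ _ _ e (by decide) (by decide) (by decide) h.l157
  · exact key _ _ _ e (by decide) (by decide) (by decide) h.l247
  · exact key _ _ _ e (by decide) (by decide) (by decide) h.l269
  · exact key _ _ _ e (by decide) (by decide) (by decide) h.l348
  · exact key _ _ _ e (by decide) (by decide) (by decide) h.l359
  · exact key _ _ _ e (by decide) (by decide) (by decide) h.l789

theorem pascalIncidence_of_not_linearIndepOn {v : Fin 9 → Fin 3 → ℂ}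
    (h : ∀ S, ¬ pascal.Indep S → ¬ LinearIndepOn ℂ v S) : PascalIncidence v := by
  have key : ∀ i j l : Fin 9, ({i, j, l} : Finset (Fin 9)) ∈ pascalLines →
      bracket (v i) (v j) (v l) = 0 := by
    intro i j l hl
    by_contra h0
    refine h ({i, j, l} : Finset (Fin 9)) (fun h1 => ((pascal_indep_coe _).1 h1).2 hl) ?_
    simpa using linearIndepOn_of_bracket_ne_zero h0
  constructor <;> exact key _ _ _ (by decide +kernel)

theorem mem_circuitVariety_pascal_iff {γ : Fin 9 × Fin 3 → ℂ} :
    γ ∈ circuitVariety pascal ↔ PascalIncidence (vec γ) := by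
  simp only [circuitVariety, mem_ofPred_eq, dep_iff_not_indep pascal_ground]
  exact ⟨pascalIncidence_of_not_linearIndepOn, fun h S hS => h.not_linearIndepOn hS⟩

theorem aeval_pascalParam {R : Type*} [CommRing R] [Algebra ℂ R] (a : Fin 20 → R) (i : Fin 9)
    (j : Fin 3) : MvPolynomial.aeval a
      (pascalParam (MvPolynomial.X : Fin 20 → MvPolynomial (Fin 20) ℂ) i j) =
        pascalParam a i j := by
  have h := congrFun (pascalParam_map (MvPolynomial.aeval (R := ℂ) a).toRingHom MvPolynomial.X i) j
  have h2 : (MvPolynomial.aeval (R := ℂ) a).toRingHom ∘ MvPolynomial.X = a := by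
    ext; simp
  rw [h2] at h
  exact h.symm

theorem aeval_planeParam {R : Type*} [CommRing R] [Algebra ℂ R] {d : ℕ}
    (a : Fin 6 ⊕ Fin d × Fin 2 → R) (i : Fin d) (j : Fin 3) :
    MvPolynomial.aeval a (planeParam
      (MvPolynomial.X : Fin 6 ⊕ Fin d × Fin 2 → MvPolynomial (Fin 6 ⊕ Fin d × Fin 2) ℂ) i j) =
        planeParam a i j := by
  have h := congrFun (planeParam_map (MvPolynomial.aeval (R := ℂ) a).toRingHom MvPolynomial.X i) j
  have h2 : (MvPolynomial.aeval (R := ℂ) a).toRingHom ∘ MvPolynomial.X = a := by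
    ext; simp
  rw [h2] at h
  exact h.symm

theorem aeval_quadParam {R : Type*} [CommRing R] [Algebra ℂ R] (a : Fin 20 → R) (i : Fin 9)
    (j : Fin 3) : MvPolynomial.aeval a
      (quadParam (MvPolynomial.X : Fin 20 → MvPolynomial (Fin 20) ℂ) i j) = quadParam a i j := by
  have h := congrFun (quadParam_map (MvPolynomial.aeval (R := ℂ) a).toRingHom MvPolynomial.X i) j
  have h2 : (MvPolynomial.aeval (R := ℂ) a).toRingHom ∘ MvPolynomial.X = a := by
    ext; simp
  rw [h2] at h
  exact h.symm

/-- Exhibiting an integral basis around each independent set reduces realizability to a finite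
decidable check. -/
theorem linearIndepOn_intCast_of_bracket {w : Fin 9 → Fin 3 → ℤ} {S : Finset (Fin 9)}
    (h : ∃ i j l, S ⊆ {i, j, l} ∧ bracket (w i) (w j) (w l) ≠ 0) :
    LinearIndepOn ℂ (fun i => Int.castRingHom ℂ ∘ w i) (S : Set (Fin 9)) := by
  obtain ⟨i, j, l, hS, hne⟩ := h
  refine (linearIndepOn_of_bracket_ne_zero (i := i) (j := j) (l := l) ?_).mono ?_
  · rw [map_bracket]
    simpa using hne
  · simpa using Finset.coe_subset.2 hS

/-- An integral realization of the Pascal configuration. -/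
def pascalWitness : Fin 9 → Fin 3 → ℤ :=
  ![![2, 1, 0], ![0, 0, 1], ![-2, 1, 1], ![2, 2, -2], ![2, -2, -2], ![2, 0, 2], ![0, 2, 1],
    ![1, 0, 0], ![0, 1, 0]]

theorem pascalParam_eq_pascalWitness :
    pascalParam ![1, 0, 0, 0, 1, 0, 0, 0, 1, 2, 1, 2, 2, 1, 2, 1, -1, -1, 2, 1] =
      pascalWitness := by
  decide +kernel

theorem pascalWitness_bracket : ∀ S : Finset (Fin 9), S.card ≤ 3 ∧ S ∉ pascalLines →
    ∃ i j l, S ⊆ {i, j, l} ∧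
      bracket (pascalWitness i) (pascalWitness j) (pascalWitness l) ≠ 0 := by
  decide +kernel

/-- The inverses of the permutations `quadOrder`. -/
def quadPosition : Fin 3 → Fin 9 → Fin 9 :=
  ![![6, 1, 7, 4, 3, 5, 0, 8, 2], ![4, 1, 6, 3, 7, 2, 5, 0, 8], ![8, 2, 5, 7, 6, 3, 1, 4, 0]]

theorem quadPosition_quadOrder : ∀ j i, quadPosition j (quadOrder j i) = i := by
  decide +kernel

theorem quadOrder_quadPosition : ∀ j i, quadOrder j (quadPosition j i) = i := by
  decide +kernel

/-- Four integral vectors and combinations of them, in the order of `quadParam`. -/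
def quadWitness : Fin 9 → Fin 3 → ℤ :=
  ![![1, 0, 0], ![1, -2, 0], ![0, 1, 0], ![0, -1, 1], ![0, 0, 1], ![1, 2, 2], ![1, 2, 1],
    ![3, 4, 2], ![0, 0, 0]]

theorem quadParam_eq_quadWitness :
    quadParam ![1, 0, 0, 0, 1, 0, 0, 0, 1, 1, 2, 1, 1, -2, -1, 1, 1, 1, 2, 1] =
      quadWitness := by
  decide +kernel

theorem quadWitness_bracket : ∀ j, ∀ S : Finset (Fin 9),
    (S.card ≤ 3 ∧ S ∉ pascalLines) ∧ quadOrder j 8 ∉ S →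
    ∃ i k l, S ⊆ {i, k, l} ∧ bracket (quadWitness (quadPosition j i))
      (quadWitness (quadPosition j k)) (quadWitness (quadPosition j l)) ≠ 0 := by
  decide +kernel

end Matroids

/-! ### The five realization spaces are parametrized. -/

section Components

theorem exists_coe_eq (S : Set (Fin 9)) : ∃ T : Finset (Fin 9), S = T := by
  classical
  exact ⟨S.toFinset, by simp⟩

theorem pascal_indep_pair {i j : Fin 9} : pascal.Indep {i, j} := by
  have h : ∀ i j : Fin 9, ({i, j} : Finset (Fin 9)).card ≤ 3 ∧ {i, j} ∉ pascalLines := by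
    decide +kernel
  simpa using (pascal_indep_coe {i, j}).2 (h i j)

theorem pascal_indep_singleton {i : Fin 9} : pascal.Indep {i} := by
  simpa using pascal_indep_pair (i := i) (j := i)

theorem pascalIncidence_of_realization {N : Matroid (Fin 9)} {γ : Fin 9 × Fin 3 → ℂ}
    (hE : N.E = univ) (hγ : γ ∈ realizationSpace N) (h : ∀ S, N.Indep S → pascal.Indep S) :
    PascalIncidence (vec γ) := by
  refine pascalIncidence_of_not_linearIndepOn fun S hS => ?_
  exact (hγ S (hE ▸ subset_univ S)).1 ((dep_iff_not_indep hE).2 fun h1 => hS (h S h1))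

theorem parametrizes_pascal : Parametrizes pascal
    (pascalParam (MvPolynomial.X : Fin 20 → MvPolynomial (Fin 20) ℂ)) where
  dep a S hS := by
    simp only [← MvPolynomial.aeval_eq_eval, aeval_pascalParam]
    exact (pascalIncidence_pascalParam a).not_linearIndepOn hS.not_indep
  indep := by
    refine ⟨Int.castRingHom ℂ ∘
      ![1, 0, 0, 0, 1, 0, 0, 0, 1, 2, 1, 2, 2, 1, 2, 1, -1, -1, 2, 1], fun S hS => ?_⟩
    obtain ⟨S, rfl⟩ := exists_coe_eq S
    have h := linearIndepOn_intCast_of_bracket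
      (pascalWitness_bracket S ((pascal_indep_coe S).1 hS))
    simp only [← MvPolynomial.aeval_eq_eval, aeval_pascalParam]
    convert h using 2 with i
    rw [pascalParam_map, pascalParam_eq_pascalWitness]
  surj γ hγ := by
    have hI := pascalIncidence_of_realization pascal_ground hγ fun _ h => h
    have hc : ∀ i j, i ≠ j → vec γ i ⨯₃ vec γ j ≠ 0 := fun i j hij =>
      cross_ne_zero_of_linearIndepOn (linearIndepOn_of_mem_realizationSpace hγ
        (pascal_indep_pair (i := i) (j := j))) (by simp) (by simp) hij
    -- If the planes of 2, 7 and of 3, 8 coincided, then 2, 3, 7 would be coplanar, but 237 is not a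
    -- line.
    have h372 : bracket (vec γ 3) (vec γ 7) (vec γ 2) ≠ 0 := by
      refine bracket_ne_zero_of_linearIndepOn (linearIndepOn_of_mem_realizationSpace hγ
        ((pascal_indep_coe {3, 7, 2}).2 (by decide +kernel))) (by simp) (by simp) (by simp)
        (by decide) (by decide) (by decide)
    obtain ⟨a, ha⟩ := exists_pascalParam hI (hc _ _ (by decide)) (hc _ _ (by decide))
      (hc _ _ (by decide)) (hc _ _ (by decide)) (hc _ _ (by decide)) (by
        intro h0
        obtain ⟨c, h1⟩ := exists_smul_eq_of_cross_eq_zero (hc 3 8 (by decide))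
          (cross_eq_zero_symm h0)
        apply h372
        have e0 := congrFun h1 0
        have e1 := congrFun h1 1
        have e2 := congrFun h1 2
        simp only [cross_apply, Matrix.cons_val, Pi.smul_apply, smul_eq_mul] at e0 e1 e2
        simp only [bracket]
        linear_combination -(vec γ 3 0) * e0 - vec γ 3 1 * e1 - vec γ 3 2 * e2)
    refine ⟨a, fun i j => ?_⟩
    rw [← MvPolynomial.aeval_eq_eval, aeval_pascalParam, ha]
    rfl

theorem bracket_planeParam {R : Type*} [CommRing R] {d : ℕ} (a : Fin 6 ⊕ Fin d × Fin 2 → R)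
    (i j l : Fin d) : bracket (planeParam a i) (planeParam a j) (planeParam a l) = 0 := by
  simp only [bracket, planeParam, Pi.add_apply, Pi.smul_apply, smul_eq_mul, Matrix.cons_val]
  ring

theorem bracket_of_realization_uniformTwo {γ : Fin 9 × Fin 3 → ℂ}
    (hγ : γ ∈ realizationSpace (uniformTwo 9)) {i j l : Fin 9} (hij : i ≠ j) (hil : i ≠ l)
    (hjl : j ≠ l) : bracket (vec γ i) (vec γ j) (vec γ l) = 0 := by
  by_contra h
  refine (hγ {i, j, l} (subset_univ _)).1 ?_ (linearIndepOn_of_bracket_ne_zero h)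
  rw [dep_iff_not_indep (uniformTwo_ground 9), uniformTwo_indep_iff,
    ncard_eq_three.2 ⟨i, j, l, hij, hil, hjl, rfl⟩]
  norm_num

theorem parametrizes_uniformTwo : Parametrizes (uniformTwo 9) (planeParam
    (MvPolynomial.X : Fin 6 ⊕ Fin 9 × Fin 2 → MvPolynomial (Fin 6 ⊕ Fin 9 × Fin 2) ℂ)) where
  dep a S hS := by
    simp only [← MvPolynomial.aeval_eq_eval, aeval_planeParam]
    intro h
    have h1 := hS.not_indep
    rw [uniformTwo_indep_iff, not_le, two_lt_ncard_iff] at h1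
    obtain ⟨i, j, l, hi, hj, hl, hij, hil, hjl⟩ := h1
    exact bracket_ne_zero_of_linearIndepOn h hi hj hl hij hil hjl (bracket_planeParam a i j l)
  indep := by
    refine ⟨Int.castRingHom ℂ ∘ Sum.elim ![1, 0, 0, 0, 1, 0]
      (fun ij => ![1, (ij.1.val : ℤ)] ij.2), fun S hS => ?_⟩
    simp only [← MvPolynomial.aeval_eq_eval, aeval_planeParam]
    obtain ⟨S, rfl⟩ := exists_coe_eq S
    rw [uniformTwo_indep_iff, ncard_coe_finset] at hS
    have h1 : ∀ S : Finset (Fin 9), S.card ≤ 2 → ∃ i j : Fin 9, i ≠ j ∧ S ⊆ {i, j} := by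
      decide +kernel
    obtain ⟨i, j, hij, hsub⟩ := h1 S hS
    refine (linearIndepOn_pair_of_cross_ne_zero (i := i) (j := j) ?_).mono
      (by simpa using Finset.coe_subset.2 hsub)
    intro h0
    have h2 := congrFun h0 2
    simp [planeParam, cross_apply] at h2
    refine hij (Fin.ext ?_)
    have h3 : ((j : ℕ) : ℂ) = (i : ℕ) := sub_eq_zero.1 h2
    exact_mod_cast h3.symm
  surj γ hγ := by
    have h01 : vec γ 0 ⨯₃ vec γ 1 ≠ 0 := by
      refine cross_ne_zero_of_linearIndepOn (S := {0, 1}) (linearIndepOn_of_mem_realizationSpace hγ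
        ?_) (by simp) (by simp) (by decide)
      rw [uniformTwo_indep_iff]
      exact ncard_insert_le _ _ |>.trans (by simp)
    obtain ⟨a, ha⟩ := exists_planeParam (v := vec γ) h01 fun i => by
      by_cases h0 : i = 0
      · subst h0; simp only [bracket]; ring
      by_cases h1 : i = 1
      · subst h1; simp only [bracket]; ring
      exact bracket_of_realization_uniformTwo hγ (by decide) (Ne.symm h0) (Ne.symm h1)
    refine ⟨a, fun i j => ?_⟩
    rw [← MvPolynomial.aeval_eq_eval, aeval_planeParam, ha]
    rfl

theorem QuadIncidence.pascalIncidence {R : Type*} [CommRing R] {v : Fin 9 → Fin 3 → R}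
    {j : Fin 3} (h : QuadIncidence (v ∘ quadOrder j)) : PascalIncidence v := by
  have hz : ∀ a b : Fin 3 → R, bracket a b 0 = 0 ∧ bracket 0 a b = 0 := by
    intro a b; simp [bracket]
  obtain ⟨h0, h1, h2, h3, h4⟩ := h
  fin_cases j
  · have h7 : v 7 = 0 := h4
    exact ⟨bracket_eq_zero_rotate (bracket_eq_zero_rotate h0), h7 ▸ (hz _ _).1, h7 ▸ (hz _ _).1,
      bracket_eq_zero_rotate (bracket_eq_zero_rotate (bracket_eq_zero_swap h3)),
      bracket_eq_zero_rotate h1, bracket_eq_zero_mid h2, h7 ▸ (hz _ _).2⟩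
  · have h8 : v 8 = 0 := h4
    exact ⟨h8 ▸ (hz _ _).1, bracket_eq_zero_rotate (bracket_eq_zero_rotate
      (bracket_eq_zero_swap h0)), bracket_eq_zero_mid h3, bracket_eq_zero_rotate h2,
      h8 ▸ (hz _ _).1, bracket_eq_zero_rotate (bracket_eq_zero_rotate h1),
      h8 ▸ bracket_eq_zero_mid (hz _ _).1⟩
  · have h9 : v 9 = 0 := h4
    exact ⟨bracket_eq_zero_rotate h0, bracket_eq_zero_mid h1,
      bracket_eq_zero_rotate (bracket_eq_zero_rotate (bracket_eq_zero_swap h2)),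
      h9 ▸ (hz _ _).1, bracket_eq_zero_rotate (bracket_eq_zero_rotate h3), h9 ▸ (hz _ _).1,
      h9 ▸ (hz _ _).1⟩

theorem quadIncidence_of_realization {j : Fin 3} {γ : Fin 9 × Fin 3 → ℂ}
    (hγ : γ ∈ realizationSpace (makeLoop pascal (quadOrder j 8))) :
    QuadIncidence (vec γ ∘ quadOrder j) := by
  refine (pascalIncidence_of_realization (makeLoop_pascal_ground _) hγ fun S hS =>
    ((makeLoop_indep_iff _ _ _).1 hS).1).quadIncidence ?_
  by_contra h0
  refine (hγ {quadOrder j 8} (subset_univ _)).1 ?_ ((linearIndepOn_singleton_iff ℂ).2 h0)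
  rw [dep_iff_not_indep (makeLoop_pascal_ground _), makeLoop_indep_iff]
  simp

theorem parametrizes_makeLoop (j : Fin 3) : Parametrizes (makeLoop pascal (quadOrder j 8))
    (quadParam (MvPolynomial.X : Fin 20 → MvPolynomial (Fin 20) ℂ) ∘ quadPosition j) where
  dep a S hS := by
    simp only [← MvPolynomial.aeval_eq_eval, Function.comp_apply, aeval_quadParam]
    have h0 := hS.not_indep
    rw [makeLoop_indep_iff] at h0
    have hQ : QuadIncidence ((fun i => quadParam a (quadPosition j i)) ∘ quadOrder j) := by
      have : (fun i => quadParam a (quadPosition j i)) ∘ quadOrder j = quadParam a := by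
        funext i
        simp [quadPosition_quadOrder]
      rw [this]
      exact quadIncidence_quadParam a
    by_cases hi : quadOrder j 8 ∈ S
    · intro h1
      exact h1.ne_zero hi hQ.zero
    · exact hQ.pascalIncidence.not_linearIndepOn fun h1 => h0 ⟨h1, hi⟩
  indep := by
    refine ⟨Int.castRingHom ℂ ∘
      ![1, 0, 0, 0, 1, 0, 0, 0, 1, 1, 2, 1, 1, -2, -1, 1, 1, 1, 2, 1], fun S hS => ?_⟩
    obtain ⟨S, rfl⟩ := exists_coe_eq S
    rw [makeLoop_indep_iff, pascal_indep_coe] at hS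
    have h := linearIndepOn_intCast_of_bracket (w := fun i => quadWitness (quadPosition j i))
      (quadWitness_bracket j S ⟨hS.1, fun h1 => hS.2 (Finset.mem_coe.2 h1)⟩)
    simp only [← MvPolynomial.aeval_eq_eval, Function.comp_apply, aeval_quadParam]
    have h2 : ∀ i, quadParam (Int.castRingHom ℂ ∘
        ![1, 0, 0, 0, 1, 0, 0, 0, 1, 1, 2, 1, 1, -2, -1, 1, 1, 1, 2, 1]) (quadPosition j i) =
        Int.castRingHom ℂ ∘ quadWitness (quadPosition j i) := fun i => by
      rw [quadParam_map, quadParam_eq_quadWitness]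
    simpa only [h2] using h
  surj γ hγ := by
    have hQ := quadIncidence_of_realization hγ
    have hc : ∀ i l, i ≠ l → i ≠ 8 → l ≠ 8 →
        (vec γ ∘ quadOrder j) i ⨯₃ (vec γ ∘ quadOrder j) l ≠ 0 := by
      intro i l hil hi hl
      have hinj : Function.Injective (quadOrder j) :=
        Function.LeftInverse.injective (quadPosition_quadOrder j)
      have hS : (makeLoop pascal (quadOrder j 8)).Indep {quadOrder j i, quadOrder j l} :=
        (makeLoop_indep_iff _ _ _).2 ⟨pascal_indep_pair, by
          simp [hinj.eq_iff, hi.symm, hl.symm]⟩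
      exact cross_ne_zero_of_linearIndepOn (v := vec γ) (i := quadOrder j i) (j := quadOrder j l)
        (linearIndepOn_of_mem_realizationSpace hγ hS) (by simp) (by simp) (hinj.ne hil)
    obtain ⟨a, ha⟩ := exists_quadParam hQ (hc _ _ (by decide) (by decide) (by decide))
      (hc _ _ (by decide) (by decide) (by decide)) (hc _ _ (by decide) (by decide) (by decide))
      (hc _ _ (by decide) (by decide) (by decide))
    refine ⟨a, fun i l => ?_⟩
    rw [← MvPolynomial.aeval_eq_eval, Function.comp_apply, aeval_quadParam, ha,
      Function.comp_apply, quadOrder_quadPosition]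
    rfl

end Components

/-! ### Polynomials that separate the components. -/

section Irredundance

/-- The generic collection of vectors. -/
noncomputable def genericVec {α : Type*} (i : α) : Fin 3 → MvPolynomial (α × Fin 3) ℂ :=
  fun j => MvPolynomial.X (i, j)

theorem aeval_comp_genericVec {α : Type*} {R : Type*} [CommRing R] [Algebra ℂ R]
    (γ : α × Fin 3 → R) (i : α) :
    (MvPolynomial.aeval (R := ℂ) γ).toRingHom ∘ genericVec i = fun j => γ (i, j) := by
  funext j
  simp [genericVec]

theorem aeval_bracket_genericVec {α : Type*} {R : Type*} [CommRing R] [Algebra ℂ R]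
    (γ : α × Fin 3 → R) (i j l : α) :
    MvPolynomial.aeval γ (bracket (genericVec i) (genericVec j) (genericVec l)) =
      bracket (fun m => γ (i, m)) (fun m => γ (j, m)) (fun m => γ (l, m)) := by
  simp [bracket, genericVec]

theorem Parametrizes.aeval_eq_zero_of_subset {α τ : Type} [Finite α] {N N' : Matroid α}
    {Φ : α → Fin 3 → MvPolynomial τ ℂ} (h : Parametrizes N Φ)
    (hsub : matroidVariety N ⊆ matroidVariety N') {f : MvPolynomial (α × Fin 3) ℂ}
    (hf : ∀ γ ∈ realizationSpace N', MvPolynomial.aeval γ f = 0) (a : τ → ℂ) :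
    MvPolynomial.aeval (fun ij => MvPolynomial.aeval a (Φ ij.1 ij.2)) f = 0 := by
  refine h.aeval_eq_zero a fun γ hγ => ?_
  simp only [matroidVariety, closure_zariskiTopology] at hsub
  exact hsub (MvPolynomial.zeroLocus_vanishingIdeal_le _ hγ) f hf

theorem not_subset_matroidVariety_makeLoop {N : Matroid (Fin 9)} {i : Fin 9}
    (hne : (realizationSpace N).Nonempty) (hN : N.Indep {i}) :
    ¬ matroidVariety N ⊆ matroidVariety (makeLoop pascal i) := by
  obtain ⟨γ, hγ⟩ := hne
  have h0 : vec γ i ≠ 0 := (linearIndepOn_of_mem_realizationSpace hγ hN).ne_zero rfl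
  obtain ⟨j, hj⟩ := Function.ne_iff.1 h0
  refine not_matroidVariety_subset hγ (MvPolynomial.X (i, j)) (fun γ' hγ' => ?_)
    (by simpa [vec] using hj)
  have h1 : vec γ' i = 0 := by
    by_contra h1
    refine (hγ' {i} (subset_univ _)).1 ?_ ((linearIndepOn_singleton_iff ℂ).2 h1)
    rw [dep_iff_not_indep (makeLoop_pascal_ground _), makeLoop_indep_iff]
    simp
  simpa [vec] using congrFun h1 j

theorem not_subset_matroidVariety_uniformTwo {N : Matroid (Fin 9)}
    (hne : (realizationSpace N).Nonempty) (hN : N.Indep {1, 2, 3}) :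
    ¬ matroidVariety N ⊆ matroidVariety (uniformTwo 9) := by
  obtain ⟨γ, hγ⟩ := hne
  refine not_matroidVariety_subset hγ
    (bracket (genericVec 1) (genericVec 2) (genericVec 3)) (fun γ' hγ' => ?_) ?_
  · rw [aeval_bracket_genericVec]
    exact bracket_of_realization_uniformTwo hγ' (by decide) (by decide) (by decide)
  · rw [aeval_bracket_genericVec]
    exact bracket_ne_zero_of_linearIndepOn (linearIndepOn_of_mem_realizationSpace hγ hN)
      (by simp) (by simp) (by simp) (by decide) (by decide) (by decide)

/-- The minor of the first two coordinates of two vectors, the bracket of them and the last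
basis vector. -/
def planarMinor {R : Type*} [CommRing R] (a b : Fin 3 → R) : R := a 0 * b 1 - a 1 * b 0

/-- The obstruction to lifting a planar collection of nine vectors to a non-planar one with the
incidences of the Pascal configuration. -/
def liftingObstruction {R : Type*} [CommRing R] (v : Fin 9 → Fin 3 → R) : R :=
  planarMinor (v 5) (v 7) * planarMinor (v 3) (v 9) * planarMinor (v 4) (v 8) *
      planarMinor (v 2) (v 7) * planarMinor (v 6) (v 9) * planarMinor (v 1) (v 8) -
    planarMinor (v 1) (v 7) * planarMinor (v 5) (v 9) * planarMinor (v 3) (v 8) *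
      planarMinor (v 4) (v 7) * planarMinor (v 2) (v 9) * planarMinor (v 6) (v 8)

/-- Expanding along the last coordinate, `[y p] x - [x p] y + [x y] p` is the bracket of `x, y, p`
times the last basis vector, hence zero; apply the functional `bracket a b`, which kills `p`. -/
theorem planarMinor_mul_bracket {R : Type*} [CommRing R] {x y p a b : Fin 3 → R}
    (h : bracket x y p = 0) (hp : bracket a b p = 0) :
    planarMinor y p * bracket a b x = planarMinor x p * bracket a b y := by
  simp only [bracket, planarMinor] at *
  linear_combination (a 0 * b 1 - a 1 * b 0) * h - (x 0 * y 1 - x 1 * y 0) * hp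

/-- Each line through one of 7, 8, 9 fixes the ratio of the heights of its other two points above
the plane of 7, 8, 9. Around the hexagon 1, 5, 3, 4, 2, 6 the nonzero heights cancel. -/
theorem liftingObstruction_eq_zero {K : Type*} [Field K] {v : Fin 9 → Fin 3 → K}
    (h : PascalIncidence v) (hne : ∀ i, i ≠ 7 → i ≠ 8 → i ≠ 9 → bracket (v 7) (v 8) (v i) ≠ 0) :
    liftingObstruction v = 0 := by
  have h7 : bracket (v 7) (v 8) (v 7) = 0 := by simp only [bracket]; ring
  have h8 : bracket (v 7) (v 8) (v 8) = 0 := by simp only [bracket]; ring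
  have e157 := planarMinor_mul_bracket h.l157 h7
  have e359 := planarMinor_mul_bracket h.l359 h.l789
  have e348 := planarMinor_mul_bracket h.l348 h8
  have e247 := planarMinor_mul_bracket h.l247 h7
  have e269 := planarMinor_mul_bracket h.l269 h.l789
  have e168 := planarMinor_mul_bracket h.l168 h8
  have n1 := hne 1 (by decide) (by decide) (by decide)
  have n2 := hne 2 (by decide) (by decide) (by decide)
  have n3 := hne 3 (by decide) (by decide) (by decide)
  have n4 := hne 4 (by decide) (by decide) (by decide)
  have n5 := hne 5 (by decide) (by decide) (by decide)
  have n6 := hne 6 (by decide) (by decide) (by decide)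
  have hprod := mul_ne_zero (mul_ne_zero (mul_ne_zero (mul_ne_zero (mul_ne_zero n1 n2) n3) n4) n5)
    n6
  refine (mul_eq_zero.1 ?_).resolve_right hprod
  have hmul : ∀ a b c d e f a' b' c' d' e' f' : K, a = a' → b = b' → c = c' → d = d' → e = e' →
      f = f' → a * b * c * d * e * f - a' * b' * c' * d' * e' * f' = 0 := by
    rintro a b c d e f _ _ _ _ _ _ rfl rfl rfl rfl rfl rfl
    exact sub_self _
  rw [← hmul _ _ _ _ _ _ _ _ _ _ _ _ e157 e359.symm e348 e247.symm e269 e168.symm]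
  simp only [liftingObstruction]
  ring

theorem not_uniformTwo_subset_pascal :
    ¬ matroidVariety (uniformTwo 9) ⊆ matroidVariety pascal := by
  intro hsub
  have hev : ∀ γ : Fin 9 × Fin 3 → ℂ, MvPolynomial.aeval γ (liftingObstruction genericVec) =
      liftingObstruction (vec γ) := by
    intro γ
    simp [liftingObstruction, planarMinor, genericVec, vec]
  have h1 := parametrizes_uniformTwo.aeval_eq_zero_of_subset hsub
    (f := liftingObstruction genericVec) (fun γ hγ => ?_)
    -- The planar collection `(1, i, 0)`, with 9 read as 0: the minor of `i, j` is `j - i`, and the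
    -- two products are 5040 and 1800.
    (Sum.elim ![1, 0, 0, 0, 1, 0] fun ij => ![1, (ij.1.val : ℂ)] ij.2)
  · rw [hev] at h1
    simp only [aeval_planeParam] at h1
    simp [liftingObstruction, planarMinor, vec, planeParam] at h1
    norm_num at h1
  · rw [hev]
    refine liftingObstruction_eq_zero (pascalIncidence_of_realization pascal_ground hγ
      fun _ h => h) fun i h7 h8 h9 => ?_
    have hI : ∀ i : Fin 9, i ≠ 7 → i ≠ 8 → i ≠ 9 →
        ({7, 8, i} : Finset (Fin 9)).card ≤ 3 ∧ {7, 8, i} ∉ pascalLines := by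
      decide +kernel
    exact bracket_ne_zero_of_linearIndepOn (linearIndepOn_of_mem_realizationSpace hγ
      ((pascal_indep_coe {7, 8, i}).2 (hI i h7 h8 h9))) (by simp) (by simp) (by simp)
      (by decide) h7.symm h8.symm

/-- Three normals orthogonal to one nonzero vector are dependent. -/
theorem bracket_cross_eq_zero {K : Type*} [Field K] {x a b c d e f : Fin 3 → K} (hx : x ≠ 0)
    (h1 : bracket a b x = 0) (h2 : bracket c d x = 0) (h3 : bracket e f x = 0) :
    bracket (a ⨯₃ b) (c ⨯₃ d) (e ⨯₃ f) = 0 := by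
  have hdot : ∀ {a b : Fin 3 → K}, bracket a b x = 0 →
      x 0 * (a ⨯₃ b) 0 + x 1 * (a ⨯₃ b) 1 + x 2 * (a ⨯₃ b) 2 = 0 := by
    intro a b h
    simp only [bracket, cross_apply, Matrix.cons_val] at h ⊢
    linear_combination h
  have d1 := hdot h1
  have d2 := hdot h2
  have d3 := hdot h3
  generalize a ⨯₃ b = n1 at *
  generalize c ⨯₃ d = n2 at *
  generalize e ⨯₃ f = n3 at *
  obtain ⟨i, hi⟩ := Function.ne_iff.1 hx
  refine (mul_eq_zero.1 ?_).resolve_left hi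
  simp only [bracket]
  fin_cases i <;> simp only [Fin.zero_eta, Fin.mk_one, Fin.reduceFinMk]
  · linear_combination (n2 1 * n3 2 - n2 2 * n3 1) * d1 + (n3 1 * n1 2 - n3 2 * n1 1) * d2 +
      (n1 1 * n2 2 - n1 2 * n2 1) * d3
  · linear_combination (n2 2 * n3 0 - n2 0 * n3 2) * d1 + (n3 2 * n1 0 - n3 0 * n1 2) * d2 +
      (n1 2 * n2 0 - n1 0 * n2 2) * d3
  · linear_combination (n2 0 * n3 1 - n2 1 * n3 0) * d1 + (n3 0 * n1 1 - n3 1 * n1 0) * d2 +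
      (n1 0 * n2 1 - n1 1 * n2 0) * d3

/-- The three lines meet at the point `quadOrder m 8` in every realization of the Pascal
configuration. Once that point is a loop, the lines spanned by the remaining pairs need not be
concurrent. -/
theorem not_makeLoop_subset_pascal_of_concurrent {m : Fin 3} {a b c d e f : Fin 9}
    (h1 : ({a, b, quadOrder m 8} : Finset (Fin 9)) ∈ pascalLines)
    (h2 : ({c, d, quadOrder m 8} : Finset (Fin 9)) ∈ pascalLines)
    (h3 : ({e, f, quadOrder m 8} : Finset (Fin 9)) ∈ pascalLines)
    (hw : bracket (quadWitness (quadPosition m a) ⨯₃ quadWitness (quadPosition m b))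
      (quadWitness (quadPosition m c) ⨯₃ quadWitness (quadPosition m d))
      (quadWitness (quadPosition m e) ⨯₃ quadWitness (quadPosition m f)) ≠ 0) :
    ¬ matroidVariety (makeLoop pascal (quadOrder m 8)) ⊆ matroidVariety pascal := by
  intro hsub
  have hev : ∀ γ : Fin 9 × Fin 3 → ℂ, MvPolynomial.aeval γ (bracket
      (genericVec a ⨯₃ genericVec b) (genericVec c ⨯₃ genericVec d)
      (genericVec e ⨯₃ genericVec f)) = bracket (vec γ a ⨯₃ vec γ b) (vec γ c ⨯₃ vec γ d)
        (vec γ e ⨯₃ vec γ f) := by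
    intro γ
    have h := map_bracket (MvPolynomial.aeval (R := ℂ) γ).toRingHom
      (genericVec a ⨯₃ genericVec b) (genericVec c ⨯₃ genericVec d)
      (genericVec e ⨯₃ genericVec f)
    simp only [map_comp_cross, aeval_comp_genericVec] at h
    exact h.symm
  have h1 := (parametrizes_makeLoop m).aeval_eq_zero_of_subset hsub
    (f := bracket (genericVec a ⨯₃ genericVec b) (genericVec c ⨯₃ genericVec d)
      (genericVec e ⨯₃ genericVec f)) (fun γ hγ => ?_)
    (Int.castRingHom ℂ ∘ ![1, 0, 0, 0, 1, 0, 0, 0, 1, 1, 2, 1, 1, -2, -1, 1, 1, 1, 2, 1])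
  · rw [hev] at h1
    have h4 : ∀ i, vec (fun ij : Fin 9 × Fin 3 => MvPolynomial.aeval (Int.castRingHom ℂ ∘
        ![1, 0, 0, 0, 1, 0, 0, 0, 1, 1, 2, 1, 1, -2, -1, 1, 1, 1, 2, 1])
        ((quadParam (MvPolynomial.X : Fin 20 → MvPolynomial (Fin 20) ℂ) ∘ quadPosition m)
          ij.1 ij.2)) i = Int.castRingHom ℂ ∘ quadWitness (quadPosition m i) := by
      intro i
      rw [← quadParam_eq_quadWitness, ← quadParam_map]
      funext j
      exact aeval_quadParam _ _ _
    simp only [h4, ← map_comp_cross, map_bracket] at h1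
    exact hw (by simpa using h1)
  · rw [hev]
    have h0 : vec γ (quadOrder m 8) ≠ 0 :=
      (linearIndepOn_of_mem_realizationSpace hγ pascal_indep_singleton).ne_zero rfl
    have key : ∀ i j l : Fin 9, ({i, j, l} : Finset (Fin 9)) ∈ pascalLines →
        bracket (vec γ i) (vec γ j) (vec γ l) = 0 := by
      intro i j l hl
      by_contra h0
      refine (hγ ({i, j, l} : Finset (Fin 9)) (subset_univ _)).1 ?_
        (by simpa using linearIndepOn_of_bracket_ne_zero h0)
      rw [dep_iff_not_indep pascal_ground, pascal_indep_coe]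
      exact fun h => h.2 hl
    exact bracket_cross_eq_zero h0 (key _ _ _ h1) (key _ _ _ h2) (key _ _ _ h3)

theorem not_makeLoop_subset_pascal (m : Fin 3) :
    ¬ matroidVariety (makeLoop pascal (quadOrder m 8)) ⊆ matroidVariety pascal := by
  fin_cases m
  · exact not_makeLoop_subset_pascal_of_concurrent (m := 0) (a := 1) (b := 5) (c := 2) (d := 4)
      (e := 8) (f := 9) (by decide +kernel) (by decide +kernel) (by decide +kernel)
      (by decide +kernel)
  · exact not_makeLoop_subset_pascal_of_concurrent (m := 1) (a := 1) (b := 6) (c := 3) (d := 4)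
      (e := 7) (f := 9) (by decide +kernel) (by decide +kernel) (by decide +kernel)
      (by decide +kernel)
  · exact not_makeLoop_subset_pascal_of_concurrent (m := 2) (a := 2) (b := 6) (c := 3) (d := 5)
      (e := 7) (f := 8) (by decide +kernel) (by decide +kernel) (by decide +kernel)
      (by decide +kernel)

end Irredundance

/-! ### Covering the circuit variety by the five components. -/

section Decomposition

/-- The equations of the circuit variety of the Pascal configuration. -/
noncomputable def pascalEquations : Set (MvPolynomial (Fin 9 × Fin 3) ℂ) :=
  {bracket (genericVec 1) (genericVec 6) (genericVec 8),
    bracket (genericVec 1) (genericVec 5) (genericVec 7),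
    bracket (genericVec 2) (genericVec 4) (genericVec 7),
    bracket (genericVec 2) (genericVec 6) (genericVec 9),
    bracket (genericVec 3) (genericVec 4) (genericVec 8),
    bracket (genericVec 3) (genericVec 5) (genericVec 9),
    bracket (genericVec 7) (genericVec 8) (genericVec 9)}

theorem encard_pascalEquations_le : pascalEquations.encard ≤ (7 : ℕ) := by
  have key : ∀ (s : Set (MvPolynomial (Fin 9 × Fin 3) ℂ)) (f) (n : ℕ), s.encard ≤ n →
      (insert f s).encard ≤ (n + 1 : ℕ) := fun s f n h =>
    (encard_insert_le s f).trans (by push_cast; gcongr)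
  exact key _ _ _ (key _ _ _ (key _ _ _ (key _ _ _ (key _ _ _ (key _ _ _ (by simp))))))

theorem pascalIncidence_iff {R : Type*} [CommRing R] [Algebra ℂ R] (γ : Fin 9 × Fin 3 → R) :
    PascalIncidence (fun i j => γ (i, j)) ↔
      ∀ f ∈ pascalEquations, MvPolynomial.aeval γ f = 0 := by
  simp only [pascalEquations, mem_insert_iff, mem_singleton_iff, forall_eq_or_imp, forall_eq,
    aeval_bracket_genericVec]
  exact ⟨fun ⟨h1, h2, h3, h4, h5, h6, h7⟩ => ⟨h1, h2, h3, h4, h5, h6, h7⟩,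
    fun ⟨h1, h2, h3, h4, h5, h6, h7⟩ => ⟨h1, h2, h3, h4, h5, h6, h7⟩⟩

theorem mem_circuitVariety_pascal_iff_aeval {γ : Fin 9 × Fin 3 → ℂ} :
    γ ∈ circuitVariety pascal ↔ ∀ f ∈ pascalEquations, MvPolynomial.aeval γ f = 0 :=
  mem_circuitVariety_pascal_iff.trans (pascalIncidence_iff γ)

theorem isClosed_circuitVariety_pascal :
    @IsClosed _ (zariskiTopology (Fin 9 × Fin 3)) (circuitVariety pascal) := by
  refine isClosed_zariskiTopology_iff.2 ⟨Ideal.span pascalEquations, ?_⟩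
  rw [MvPolynomial.zeroLocus_span]
  ext γ
  exact mem_circuitVariety_pascal_iff_aeval

theorem matroidVariety_subset_circuitVariety {N : Matroid (Fin 9)} (hE : N.E = univ)
    (h : ∀ S, N.Indep S → pascal.Indep S) : matroidVariety N ⊆ circuitVariety pascal := by
  let _ := zariskiTopology (Fin 9 × Fin 3)
  refine closure_minimal (fun γ hγ => ?_) isClosed_circuitVariety_pascal
  exact mem_circuitVariety_pascal_iff.2 (pascalIncidence_of_realization hE hγ h)

theorem uniformTwo_indep_pascal {S : Set (Fin 9)} (hS : (uniformTwo 9).Indep S) :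
    pascal.Indep S := by
  obtain ⟨S, rfl⟩ := exists_coe_eq S
  rw [uniformTwo_indep_iff, ncard_coe_finset] at hS
  rw [pascal_indep_coe]
  revert S
  decide +kernel

theorem Parametrizes.mem_of_generic {α τ : Type} [Finite α] {N : Matroid α}
    {Φ : α → Fin 3 → MvPolynomial τ ℂ} (h : Parametrizes N Φ) {K : Type*} [Field K] [Algebra ℂ K]
    {x : α × Fin 3 → K} {γ : α × Fin 3 → ℂ}
    (hγ : ∀ f : MvPolynomial (α × Fin 3) ℂ, MvPolynomial.aeval x f = 0 → MvPolynomial.aeval γ f = 0)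
    (a : τ → K)
    (hx : ∀ i j, x (i, j) = MvPolynomial.aeval a (Φ i j)) : γ ∈ matroidVariety N := by
  rw [matroidVariety, closure_zariskiTopology]
  intro f hf
  refine hγ f ?_
  rw [show x = fun ij => MvPolynomial.aeval a (Φ ij.1 ij.2) from funext fun ij => hx ij.1 ij.2]
  exact h.aeval_eq_zero a hf

theorem circuitVariety_pascal_subset {γ : Fin 9 × Fin 3 → ℂ} (hγ : γ ∈ circuitVariety pascal) :
    γ ∈ matroidVariety pascal ∨ γ ∈ matroidVariety (uniformTwo 9) ∨
      ∃ j, γ ∈ matroidVariety (makeLoop pascal (quadOrder j 8)) := by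
  rw [mem_circuitVariety_pascal_iff_aeval] at hγ
  let m := MvPolynomial.vanishingIdeal ℂ {γ}
  have hm : m.IsMaximal := MvPolynomial.isMaximal_iff_eq_vanishingIdeal_singleton.2 ⟨γ, rfl⟩
  -- The numbers are `7 + 19 < 27`. The prime `P` defines a subvariety through `γ`, and `x` below is
  -- its generic point.
  obtain ⟨P, hP, hsP, hPm, htr⟩ := exists_isPrime_le_trdeg pascalEquations m
    (fun f hf => (MvPolynomial.mem_vanishingIdeal_singleton_iff γ f).2 (hγ f hf))
    (r := 19) encard_pascalEquations_le (by simp)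
  let A := MvPolynomial (Fin 9 × Fin 3) ℂ ⧸ P
  let K := FractionRing A
  let x : Fin 9 × Fin 3 → K := fun ij => algebraMap A K (Ideal.Quotient.mk P (MvPolynomial.X ij))
  have hx : ∀ f, MvPolynomial.aeval x f = algebraMap A K (Ideal.Quotient.mk P f) := by
    intro f
    have : MvPolynomial.aeval x = (IsScalarTower.toAlgHom ℂ A K).comp (Ideal.Quotient.mkₐ ℂ P) := by
      ext ij
      simp [x]
      rfl
    rw [this]
    rfl
  have hx0 : ∀ f, MvPolynomial.aeval x f = 0 ↔ f ∈ P := by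
    intro f
    rw [hx, ← Ideal.Quotient.eq_zero_iff_mem]
    exact map_eq_zero_iff _ (IsFractionRing.injective A K)
  have hxγ : ∀ f, MvPolynomial.aeval x f = 0 → MvPolynomial.aeval γ f = 0 := fun f hf =>
    (MvPolynomial.mem_vanishingIdeal_singleton_iff γ f).1 (hPm ((hx0 f).1 hf))
  have hI : PascalIncidence fun i j => x (i, j) :=
    (pascalIncidence_iff x).2 fun f hf => (hx0 f).2 (hsP hf)
  rcases hI.classification (k := ℂ) with ⟨a, ha⟩ | ⟨a, ha⟩ | ⟨j, a, ha⟩ | ⟨t, ht, h⟩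
  · refine Or.inl (parametrizes_pascal.mem_of_generic hxγ a fun i j => ?_)
    rw [aeval_pascalParam, ha]
  · refine Or.inr (Or.inl (parametrizes_uniformTwo.mem_of_generic hxγ a fun i j => ?_))
    rw [aeval_planeParam, ha]
  · refine Or.inr (Or.inr ⟨j, (parametrizes_makeLoop j).mem_of_generic hxγ a fun i l => ?_⟩)
    rw [Function.comp_apply, aeval_quadParam, ha, Function.comp_apply, quadOrder_quadPosition]
  · refine absurd ?_ htr
    refine (MvPolynomial.trdeg_le_of_surjective (K := K) (Ideal.Quotient.mkₐ ℂ P)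
      (Ideal.Quotient.mkₐ_surjective ℂ P) t fun ij => h _ ⟨ij.1, rfl⟩ ij.2).trans ?_
    exact_mod_cast ht

end Decomposition

theorem mainTheorem6 :
    IsIrredundantIrreducibleDecomposition (circuitVariety pascal)
      ![matroidVariety pascal,
        matroidVariety (uniformTwo 9),
        matroidVariety (makeLoop pascal 7),
        matroidVariety (makeLoop pascal 8),
        matroidVariety (makeLoop pascal 9)] := by
  have hloop : ∀ (i : Fin 9) (S), (makeLoop pascal i).Indep S → pascal.Indep S := fun i S h =>
    ((makeLoop_indep_iff _ _ _).1 h).1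
  have nP := parametrizes_pascal.nonempty
  have nU := parametrizes_uniformTwo.nonempty
  have n7 : (realizationSpace (makeLoop pascal 7)).Nonempty := (parametrizes_makeLoop 0).nonempty
  have n8 : (realizationSpace (makeLoop pascal 8)).Nonempty := (parametrizes_makeLoop 1).nonempty
  have n9 : (realizationSpace (makeLoop pascal 9)).Nonempty := (parametrizes_makeLoop 2).nonempty
  have i123 : pascal.Indep {1, 2, 3} := by
    simpa using (pascal_indep_coe {1, 2, 3}).2 (by decide +kernel)
  have j123 : ∀ i : Fin 9, i ≠ 1 → i ≠ 2 → i ≠ 3 → (makeLoop pascal i).Indep {1, 2, 3} :=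
    fun i h1 h2 h3 => (makeLoop_indep_iff _ _ _).2 ⟨i123, by simp [h1, h2, h3]⟩
  have iU : ∀ i, (uniformTwo 9).Indep {i} := fun i => by simp [uniformTwo_indep_iff]
  have iL : ∀ i j : Fin 9, i ≠ j → (makeLoop pascal i).Indep {j} := fun i j hij =>
    (makeLoop_indep_iff _ _ _).2 ⟨pascal_indep_singleton, by simpa using hij⟩
  refine ⟨?_, ?_, ?_, ?_⟩
  · apply subset_antisymm
    · intro γ hγ
      rw [mem_iUnion]
      rcases circuitVariety_pascal_subset hγ with h | h | ⟨j, h⟩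
      · exact ⟨0, h⟩
      · exact ⟨1, h⟩
      · fin_cases j
        exacts [⟨2, h⟩, ⟨3, h⟩, ⟨4, h⟩]
    · refine iUnion_subset fun k => ?_
      fin_cases k
      · exact matroidVariety_subset_circuitVariety pascal_ground fun _ h => h
      · exact matroidVariety_subset_circuitVariety (uniformTwo_ground 9)
          fun _ => uniformTwo_indep_pascal
      all_goals exact matroidVariety_subset_circuitVariety (makeLoop_pascal_ground _) (hloop _)
  · intro k
    fin_cases k <;> exact isClosed_matroidVariety _
  · intro k
    fin_cases k
    exacts [parametrizes_pascal.isIrreducible, parametrizes_uniformTwo.isIrreducible,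
      (parametrizes_makeLoop 0).isIrreducible, (parametrizes_makeLoop 1).isIrreducible,
      (parametrizes_makeLoop 2).isIrreducible]
  · intro k l hkl
    fin_cases k <;> fin_cases l <;> first | exact absurd rfl hkl | skip
    · exact not_subset_matroidVariety_uniformTwo nP i123
    · exact not_subset_matroidVariety_makeLoop nP pascal_indep_singleton
    · exact not_subset_matroidVariety_makeLoop nP pascal_indep_singleton
    · exact not_subset_matroidVariety_makeLoop nP pascal_indep_singleton
    · exact not_uniformTwo_subset_pascal
    · exact not_subset_matroidVariety_makeLoop nU (iU _)
    · exact not_subset_matroidVariety_makeLoop nU (iU _)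
    · exact not_subset_matroidVariety_makeLoop nU (iU _)
    · exact not_makeLoop_subset_pascal 0
    · exact not_subset_matroidVariety_uniformTwo n7 (j123 _ (by decide) (by decide) (by decide))
    · exact not_subset_matroidVariety_makeLoop n7 (iL _ _ (by decide))
    · exact not_subset_matroidVariety_makeLoop n7 (iL _ _ (by decide))
    · exact not_makeLoop_subset_pascal 1
    · exact not_subset_matroidVariety_uniformTwo n8 (j123 _ (by decide) (by decide) (by decide))
    · exact not_subset_matroidVariety_makeLoop n8 (iL _ _ (by decide))
    · exact not_subset_matroidVariety_makeLoop n8 (iL _ _ (by decide))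
    · exact not_makeLoop_subset_pascal 2
    · exact not_subset_matroidVariety_uniformTwo n9 (j123 _ (by decide) (by decide) (by decide))
    · exact not_subset_matroidVariety_makeLoop n9 (iL _ _ (by decide))
    · exact not_subset_matroidVariety_makeLoop n9 (iL _ _ (by decide))
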